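/- All rings are associative with unit and not necessarily commutative, and modules are right modules. For a ring $R$, a pp-$n$-formula $\varphi$ over $R$ is a formula $\exists \mathbf y\,(\mathbf x\,\mathbf y)A=0$, where $\mathbf x$ is an $n$-tuple of variables, $\mathbf y$ is a finite tuple of variables and $A$ is a matrix over $R$; its solution set $\varphi(M)$ is a subgroup of $M^n$. For a class $X$ of $R$-modules, $\mathrm{pp}^1_R(X)$ denotes the (bounded modular) lattice of pp-$1$-formulas, ordered by inclusion of solution sets on all $M\in X$ and taken modulo equality of solution sets on all $M\in X$. An embedding $i\colon M\to N$ is pure if $\varphi(N)\cap iM=i\varphi(M)$ for all pp-$1$-formulas $\varphi$; a module is pure-injective if every pure embedding out of it splits. A full subcategory of $\mathrm{Mod}\text{-}R$ is definable if it is closed under products, direct limits and pure submodules; $\langle X\rangle$ is the smallest definable subcategory containing $X$. Let $\mathcal C\subseteq \mathrm{Mod}\text{-}R$ and $\mathcal D\subseteq\mathrm{Mod}\text{-}S$ be definable subcategories. A functor $I\colon\mathcal C\to\mathcal D$ is an interpretation functor if there are a number $m$, pp-$m$-formulas $\varphi,\psi$ over $R$ with $\psi(M)\subseteq\varphi(M)$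 for all $R$-modules $M$, and pp-$2m$-formulas $\rho_s$ ($s\in S$), such that for each $M\in\mathcal C$ every $\rho_s$ induces the graph of an endomorphism of the group $\varphi(M)/\psi(M)$, these endomorphisms make $\varphi(M)/\psi(M)$ an $S$-module in $\mathcal D$, and $I$ is naturally isomorphic to the functor $M\mapsto\varphi(M)/\psi(M)$. It is full on pure-injectives if for all pure-injective $M,N\in\mathcal C$ every homomorphism $IM\to IN$ is of the form $If$ with $f\colon M\to N$. Its kernel is $\ker I=\{M\in\mathcal C: IM=0\}$. Let $\mathcal L$ be a non-empty class of lattices closed under sublattices and quotient lattices. For a bounded modular lattice $L$ define congruences $\sim_\alpha$ on $L$ ($\alpha$ an ordinal): $\sim_0$ is equality; $\sim_{\alpha+1}$ is the congruence generated by $\sim_\alpha$ and all pairs $(a,b)$ for which the classes satisfy $[a]\le[b]$ in $L/{\sim_\alpha}$ and the interval between $[a]$ and $[b]$ in $L/{\sim_\alpha}$ belongs to $\mathcal L$; at limit ordinals one takes the union. The $\mathcal L$-dimension $\mathcal L\text{-}\dim L$ is $-1$ if $L$ has one element, and otherwise the least ordinal $\alpha$ such that $L/{\sim_{\alpha+1}}$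 has one element; if there is no such $\alpha$, it does not exist, and we then write $\mathcal L\text{-}\dim L=\infty$. **Proposition.** Let $\mathcal L$ be a non-empty class of lattices closed under sublattices and quotient lattices. Let $R,S$ be rings, let $\mathcal C\subseteq \mathrm{Mod}\text{-}R$ and $\mathcal D\subseteq\mathrm{Mod}\text{-}S$ be definable subcategories, and let $I\colon\mathcal C\to\mathcal D$ be an interpretation functor which is full on pure-injectives and satisfies $\langle I\mathcal C\rangle=\mathcal D$. Then $$\max\{\mathcal L\text{-}\dim \mathrm{pp}^1_S(\mathcal D),\ \mathcal L\text{-}\dim \mathrm{pp}^1_R(\ker I)\}\ \le\ \mathcal L\text{-}\dim \mathrm{pp}^1_R(\mathcal C)\ \le\ \mathcal L\text{-}\dim \mathrm{pp}^1_S(\mathcal D)+1+\mathcal L\text{-}\dim \mathrm{pp}^1_R(\ker I),$$ where $-1<\alpha<\infty$ for every ordinal $\alpha$, $-1+1+\beta=\beta$, $\alpha+1+(-1)=\alpha$, and the sum is $\infty$ if one of its terms is. In particular, $\mathcal L\text{-}\dim \mathrm{pp}^1_R(\mathcal C)$ exists if and only if both $\mathcal L\text{-}\dim \mathrm{pp}^1_R(\ker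 I)$ and $\mathcal L\text{-}\dim \mathrm{pp}^1_S(\mathcal D)$ exist. -/

import Mathlib

open CategoryTheory CategoryTheory.Limits

universe u v w

noncomputable section

/-! ## Positive primitive formulas and the lattices they form

Everything is set up for left modules over an arbitrary (not necessarily commutative) ring `A`;
right `R`-modules are the modules over `A = Rᵐᵒᵖ`. -/

/-- A pp-formula in the free variables `ν`: existentially quantify `bound` many variables in a
conjunction of `eqs` many homogeneous linear equations; the coefficient of the variable `i` in the
equation `j` is `mat i j`. -/
structure PPFormula (A : Type u) (ν : Type) where
  bound : ℕ
  eqs : ℕ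
  mat : ν ⊕ Fin bound → Fin eqs → A

namespace PPFormula

variable {A : Type u} [Ring A] {ν : Type} [Fintype ν]

/-- The solution set `φ(M)`, a subgroup of `M ^ ν`. -/
def sol (φ : PPFormula A ν) (M : Type v) [AddCommGroup M] [Module A M] : AddSubgroup (ν → M) where
  carrier := {x | ∃ y : Fin φ.bound → M, ∀ j, ∑ i, φ.mat i j • Sum.elim x y i = 0}
  zero_mem' := ⟨0, fun j => Finset.sum_eq_zero fun i _ => by rcases i with i | i <;> simp⟩
  add_mem' := by
    rintro x x' ⟨y, hy⟩ ⟨y', hy'⟩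
    refine ⟨y + y', fun j => ?_⟩
    have h := congrArg₂ (· + ·) (hy j) (hy' j)
    simp only [← Finset.sum_add_distrib, ← smul_add, add_zero] at h
    rw [← h]
    refine Finset.sum_congr rfl fun i _ => ?_
    rcases i with i | i <;> simp
  neg_mem' := by
    rintro x ⟨y, hy⟩
    refine ⟨-y, fun j => ?_⟩
    have h := congrArg Neg.neg (hy j)
    rw [← Finset.sum_neg_distrib, neg_zero] at h
    rw [← h]
    refine Finset.sum_congr rfl fun i _ => ?_
    rcases i with i | i <;> simp

theorem mem_sol (φ : PPFormula A ν) {M : Type v} [AddCommGroup M] [Module A M] (x : ν → M) :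
    x ∈ φ.sol M ↔ ∃ y : Fin φ.bound → M, ∀ j, ∑ i, φ.mat i j • Sum.elim x y i = 0 :=
  Iff.rfl

/-- Homomorphisms map solutions to solutions. -/
theorem map_mem_sol (φ : PPFormula A ν) {M : Type v} {N : Type w} [AddCommGroup M] [Module A M]
    [AddCommGroup N] [Module A N] (f : M →ₗ[A] N) {x : ν → M} (hx : x ∈ φ.sol M) :
    f ∘ x ∈ φ.sol N := by
  obtain ⟨y, hy⟩ := hx
  refine ⟨f ∘ y, fun j => ?_⟩
  have h := congrArg f (hy j)
  simp only [map_sum, map_smul, map_zero] at h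
  rw [← h]
  refine Finset.sum_congr rfl fun i _ => ?_
  rcases i with i | i <;> simp

/-- A pp-formula whose bound variables and equations are indexed by arbitrary finite types. -/
def ofCoeffs {κ ι : Type} [Fintype κ] [Fintype ι] (B : ν ⊕ κ → ι → A) : PPFormula A ν where
  bound := Fintype.card κ
  eqs := Fintype.card ι
  mat := fun i j => B (Sum.map id (Fintype.equivFin κ).symm i) ((Fintype.equivFin ι).symm j)

theorem mem_sol_ofCoeffs {κ ι : Type} [Fintype κ] [Fintype ι] (B : ν ⊕ κ → ι → A)
    {M : Type v} [AddCommGroup M] [Module A M] (x : ν → M) :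
    x ∈ (ofCoeffs B).sol M ↔ ∃ y : κ → M, ∀ j, ∑ i, B i j • Sum.elim x y i = 0 := by
  rw [mem_sol]
  constructor
  · rintro ⟨y, hy⟩
    refine ⟨fun k => y (Fintype.equivFin κ k), fun j => ?_⟩
    have h := hy (Fintype.equivFin ι j)
    rw [← h, Fintype.sum_sum_type, Fintype.sum_sum_type]
    congr 1
    · exact Finset.sum_congr rfl fun k _ => by simp [ofCoeffs]; rfl
    · exact Fintype.sum_equiv (Fintype.equivFin κ) _ _ (fun k => by simp [ofCoeffs]; rfl)
  · rintro ⟨y, hy⟩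
    refine ⟨y ∘ (Fintype.equivFin κ).symm, fun j => ?_⟩
    have h := hy ((Fintype.equivFin ι).symm j)
    rw [← h, Fintype.sum_sum_type, Fintype.sum_sum_type]
    congr 1
    exact Fintype.sum_equiv (Fintype.equivFin κ).symm _ _ (fun k => by simp [ofCoeffs])

/-- The conjunction `φ ∧ ψ`. -/
def conj (φ ψ : PPFormula A ν) : PPFormula A ν :=
  ofCoeffs (κ := Fin φ.bound ⊕ Fin ψ.bound) (ι := Fin φ.eqs ⊕ Fin ψ.eqs) fun i j =>
    match i, j with
    | .inl a, .inl j => φ.mat (.inl a) j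
    | .inl a, .inr j => ψ.mat (.inl a) j
    | .inr (.inl b), .inl j => φ.mat (.inr b) j
    | .inr (.inl _), .inr _ => 0
    | .inr (.inr _), .inl _ => 0
    | .inr (.inr b), .inr j => ψ.mat (.inr b) j

/-- The sum `φ + ψ`, i.e. `∃ x', φ(x') ∧ ψ(x - x')`. -/
def add (φ ψ : PPFormula A ν) : PPFormula A ν :=
  ofCoeffs (κ := ν ⊕ (Fin φ.bound ⊕ Fin ψ.bound)) (ι := Fin φ.eqs ⊕ Fin ψ.eqs) fun i j =>
    match i, j with
    | .inl _, .inl _ => 0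
    | .inl a, .inr j => ψ.mat (.inl a) j
    | .inr (.inl a), .inl j => φ.mat (.inl a) j
    | .inr (.inl a), .inr j => -ψ.mat (.inl a) j
    | .inr (.inr (.inl b)), .inl j => φ.mat (.inr b) j
    | .inr (.inr (.inl _)), .inr _ => 0
    | .inr (.inr (.inr _)), .inl _ => 0
    | .inr (.inr (.inr b)), .inr j => ψ.mat (.inr b) j

theorem sol_conj (φ ψ : PPFormula A ν) (M : Type v) [AddCommGroup M] [Module A M] :
    (φ.conj ψ).sol M = φ.sol M ⊓ ψ.sol M := by
  ext x
  rw [AddSubgroup.mem_inf, conj, mem_sol_ofCoeffs, mem_sol, mem_sol]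
  constructor
  · rintro ⟨y, hy⟩
    refine ⟨⟨y ∘ .inl, fun j => ?_⟩, ⟨y ∘ .inr, fun j => ?_⟩⟩
    · simpa [Fintype.sum_sum_type] using hy (.inl j)
    · simpa [Fintype.sum_sum_type] using hy (.inr j)
  · rintro ⟨⟨y, hy⟩, ⟨y', hy'⟩⟩
    refine ⟨Sum.elim y y', fun j => ?_⟩
    rcases j with j | j
    · simpa [Fintype.sum_sum_type] using hy j
    · simpa [Fintype.sum_sum_type] using hy' j

theorem sol_add (φ ψ : PPFormula A ν) (M : Type v) [AddCommGroup M] [Module A M] :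
    (φ.add ψ).sol M = φ.sol M ⊔ ψ.sol M := by
  ext x
  rw [AddSubgroup.mem_sup, add, mem_sol_ofCoeffs]
  constructor
  · rintro ⟨y, hy⟩
    refine ⟨y ∘ .inl, ⟨y ∘ .inr ∘ .inl, fun j => ?_⟩, x - y ∘ .inl,
      ⟨y ∘ .inr ∘ .inr, fun j => ?_⟩, by simp⟩
    · simpa [Fintype.sum_sum_type] using hy (.inl j)
    · have := hy (.inr j)
      simp only [Fintype.sum_sum_type, Sum.elim_inl, Sum.elim_inr, neg_smul, zero_smul,
        Finset.sum_neg_distrib, Finset.sum_const_zero, zero_add] at this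
      simp only [Fintype.sum_sum_type, Sum.elim_inl, Sum.elim_inr, Pi.sub_apply, smul_sub,
        Finset.sum_sub_distrib, Function.comp_apply]
      rw [← this]
      abel
  · rintro ⟨x₁, ⟨y, hy⟩, x₂, ⟨y', hy'⟩, rfl⟩
    refine ⟨Sum.elim x₁ (Sum.elim y y'), fun j => ?_⟩
    rcases j with j | j
    · simpa [Fintype.sum_sum_type] using hy j
    · simpa [Fintype.sum_sum_type, Finset.sum_add_distrib, add_assoc, add_comm, add_left_comm]
        using hy' j

/-- Equality of solution sets on the modules in `X`. -/
def setoidOn (ν : Type) [Fintype ν] (X : ObjectProperty (ModuleCat.{u} A)) :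
    Setoid (PPFormula A ν) where
  r φ ψ := ∀ M : ModuleCat.{u} A, X M → φ.sol M = ψ.sol M
  iseqv := ⟨fun _ _ _ => rfl, fun h M hM => (h M hM).symm,
    fun h h' M hM => (h M hM).trans (h' M hM)⟩

end PPFormula

/-- The lattice of pp-formulas in the free variables `ν`, modulo equality of solution sets on the
modules in `X`. -/
def PPLattice {A : Type u} [Ring A] (ν : Type) [Fintype ν]
    (X : ObjectProperty (ModuleCat.{u} A)) : Type u :=
  Quotient (PPFormula.setoidOn ν X)

namespace PPLattice

variable {A : Type u} [Ring A] {ν : Type} [Fintype ν] {X : ObjectProperty (ModuleCat.{u} A)}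

/-- The class of a formula. -/
def mk (X : ObjectProperty (ModuleCat.{u} A)) (φ : PPFormula A ν) : PPLattice ν X :=
  Quotient.mk (PPFormula.setoidOn ν X) φ

theorem ind {P : PPLattice ν X → Prop} (h : ∀ φ, P (mk X φ)) (p : PPLattice ν X) : P p :=
  Quotient.inductionOn (s := PPFormula.setoidOn ν X) p h

/-- The solution set on a module in `X` of a class of formulas. -/
def sol (p : PPLattice ν X) (M : ModuleCat.{u} A) (hM : X M) : AddSubgroup (ν → M) :=
  Quotient.lift (s := PPFormula.setoidOn ν X) (fun φ : PPFormula A ν => φ.sol M)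
    (fun _ _ h => h M hM) p

theorem ext_sol {p q : PPLattice ν X} (h : ∀ M hM, p.sol M hM = q.sol M hM) : p = q := by
  induction p using ind
  induction q using ind
  exact Quotient.sound (s := PPFormula.setoidOn ν X) fun M hM => h M hM

/-- The order is inclusion of solution sets on all modules in `X`. -/
instance : PartialOrder (PPLattice ν X) where
  le p q := ∀ M hM, p.sol M hM ≤ q.sol M hM
  le_refl _ _ _ := le_rfl
  le_trans _ _ _ h h' M hM := (h M hM).trans (h' M hM)
  le_antisymm _ _ h h' := ext_sol fun M hM => le_antisymm (h M hM) (h' M hM)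

/-- The class of `φ ∧ ψ`. -/
def inf (p q : PPLattice ν X) : PPLattice ν X :=
  Quotient.map₂ (sa := PPFormula.setoidOn ν X) (sb := PPFormula.setoidOn ν X)
    (sc := PPFormula.setoidOn ν X) PPFormula.conj
    (fun a b h a' b' h' M hM => by
      rw [PPFormula.sol_conj, PPFormula.sol_conj, h M hM, h' M hM]) p q

/-- The class of `φ + ψ`. -/
def sup (p q : PPLattice ν X) : PPLattice ν X :=
  Quotient.map₂ (sa := PPFormula.setoidOn ν X) (sb := PPFormula.setoidOn ν X)
    (sc := PPFormula.setoidOn ν X) PPFormula.add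
    (fun a b h a' b' h' M hM => by
      rw [PPFormula.sol_add, PPFormula.sol_add, h M hM, h' M hM]) p q

theorem sol_inf (p q : PPLattice ν X) (M : ModuleCat.{u} A) (hM : X M) :
    (inf p q).sol M hM = p.sol M hM ⊓ q.sol M hM := by
  induction p using ind with | _ φ
  induction q using ind with | _ ψ
  exact PPFormula.sol_conj φ ψ M

theorem sol_sup (p q : PPLattice ν X) (M : ModuleCat.{u} A) (hM : X M) :
    (sup p q).sol M hM = p.sol M hM ⊔ q.sol M hM := by
  induction p using ind with | _ φ
  induction q using ind with | _ ψ
  exact PPFormula.sol_add φ ψ M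

/-- Meet is conjunction and join is sum of pp-formulas. -/
instance : Lattice (PPLattice ν X) where
  inf := inf
  sup := sup
  inf_le_left p q M hM := (sol_inf p q M hM).le.trans inf_le_left
  inf_le_right p q M hM := (sol_inf p q M hM).le.trans inf_le_right
  le_inf _ q r h h' M hM := (le_inf (h M hM) (h' M hM)).trans (sol_inf q r M hM).ge
  le_sup_left p q M hM := le_sup_left.trans (sol_sup p q M hM).ge
  le_sup_right p q M hM := le_sup_right.trans (sol_sup p q M hM).ge
  sup_le p q _ h h' M hM := (sol_sup p q M hM).le.trans (sup_le (h M hM) (h' M hM))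

end PPLattice

/-! ## Purity and definable subcategories -/

section Definable

variable {A : Type u} [Ring A]

/-- A pure embedding: an injective homomorphism with `φ(N) ∩ f(M) = f(φ(M))` for all
pp-formulas `φ` in one free variable. -/
def IsPureEmbedding {M N : ModuleCat.{u} A} (f : M ⟶ N) : Prop :=
  Function.Injective f.hom ∧
    ∀ (φ : PPFormula A (Fin 1)) (x : Fin 1 → M), f.hom ∘ x ∈ φ.sol N ↔ x ∈ φ.sol M

/-- A module is pure-injective if every pure embedding out of it splits. -/
def IsPureInjective (M : ModuleCat.{u} A) : Prop :=
  ∀ (N : ModuleCat.{u} A) (f : M ⟶ N), IsPureEmbedding f → ∃ g : N ⟶ M, f ≫ g = 𝟙 M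

/-- A full subcategory (given by a class of modules) is definable if it is closed under products,
direct limits and pure submodules. (Isomorphisms are pure embeddings, so closure under isomorphism
is included.) -/
structure IsDefinable (X : ObjectProperty (ModuleCat.{u} A)) : Prop where
  product : ∀ (ι : Type u) (M : ι → ModuleCat.{u} A), (∀ i, X (M i)) →
    X (ModuleCat.of A (∀ i, M i))
  directLimit : ∀ (J : Type u) [Preorder J] [IsDirectedOrder J] [Nonempty J]
    (F : J ⥤ ModuleCat.{u} A) (c : Cocone F), IsColimit c → (∀ j, X (F.obj j)) → X c.pt
  pureSubmodule : ∀ (M N : ModuleCat.{u} A) (f : M ⟶ N), IsPureEmbedding f → X N → X M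

/-- The smallest definable subcategory containing `X`. -/
def definableClosure (X : ObjectProperty (ModuleCat.{u} A)) : ObjectProperty (ModuleCat.{u} A) :=
  fun M => ∀ E : ObjectProperty (ModuleCat.{u} A), IsDefinable E → X ≤ E → E M

end Definable

/-! ## Interpretation functors -/

/-- The abelian group `φ(M) / ψ(M)` for a pp-pair `φ / ψ` (so `ψ(M) ⊆ φ(M)`). -/
abbrev PPQuotient {A : Type u} [Ring A] {ν : Type} [Fintype ν] (φ ψ : PPFormula A ν)
    (M : Type v) [AddCommGroup M] [Module A M] : Type v :=
  φ.sol M ⧸ (ψ.sol M).addSubgroupOf (φ.sol M)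

section Interpretation

variable {A B : Type u} [Ring A] [Ring B]
  {C : ObjectProperty (ModuleCat.{u} A)} {D : ObjectProperty (ModuleCat.{u} B)}

/-- `I : C ⥤ D` is an interpretation functor if there are a pp-pair `φ / ψ` and pp-formulas
`ρ b`, `b : B`, such that on `C` the relation induced by `ρ b` on `φ(M) / ψ(M)` is the graph of an
endomorphism of the group `φ(M) / ψ(M)`, these endomorphisms make `φ(M) / ψ(M)` a `B`-module in
`D`, and `I` is equivalent to the functor `M ↦ φ(M) / ψ(M)` so obtained. The equivalence is given by
additive isomorphisms `e M : φ(M) / ψ(M) ≃ I M`, natural in `M`, which carry the relation induced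
by `ρ b` to the graph of the action of `b` on the module `I M` of `D`. -/
def IsInterpretationFunctor (I : C.FullSubcategory ⥤ D.FullSubcategory) : Prop :=
  ∃ (m : ℕ) (φ ψ : PPFormula A (Fin m)) (ρ : B → PPFormula A (Fin m ⊕ Fin m))
    (_ : ∀ M : ModuleCat.{u} A, ψ.sol M ≤ φ.sol M)
    (e : ∀ M : C.FullSubcategory, PPQuotient φ ψ M.obj ≃+ (I.obj M).obj),
    (∀ (M N : C.FullSubcategory) (f : M ⟶ N) (x : φ.sol M.obj),
      (I.map f).hom.hom (e M (QuotientAddGroup.mk x)) =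
        e N (QuotientAddGroup.mk ⟨f.hom.hom ∘ x.1, φ.map_mem_sol f.hom.hom x.2⟩)) ∧
    (∀ (M : C.FullSubcategory) (b : B) (p q : PPQuotient φ ψ M.obj),
      b • e M p = e M q ↔
        ∃ x y : φ.sol M.obj, QuotientAddGroup.mk x = p ∧ QuotientAddGroup.mk y = q ∧
          Sum.elim x.1 y.1 ∈ (ρ b).sol M.obj)

/-- `I` is full on pure-injectives. -/
def IsFullOnPureInjectives (I : C.FullSubcategory ⥤ D.FullSubcategory) : Prop :=
  ∀ M N : C.FullSubcategory, IsPureInjective M.obj → IsPureInjective N.obj →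
    ∀ g : I.obj M ⟶ I.obj N, ∃ f : M ⟶ N, I.map f = g

/-- The kernel of `I`: the modules `M` in `C` with `I M = 0`. -/
def kernelClass (I : C.FullSubcategory ⥤ D.FullSubcategory) : ObjectProperty (ModuleCat.{u} A) :=
  fun M => ∃ h : C M, Subsingleton (I.obj ⟨M, h⟩).obj

/-- The class of the modules `I M` with `M` in `C`. -/
def imageClass (I : C.FullSubcategory ⥤ D.FullSubcategory) : ObjectProperty (ModuleCat.{u} B) :=
  fun N => ∃ M : C.FullSubcategory, (I.obj M).obj = N

end Interpretation

/-! ## Dimensions of lattices -/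

/-- The quotient of a lattice by a lattice congruence. -/
def LatticeCon.Quot {L : Type u} [Lattice L] (c : LatticeCon L) : Type u :=
  Quotient c.toSetoid

/-- The class of an element. -/
def LatticeCon.toQuot {L : Type u} [Lattice L] (c : LatticeCon L) (a : L) : c.Quot :=
  Quotient.mk c.toSetoid a

/-- The quotient lattice. -/
instance LatticeCon.quotLattice {L : Type u} [Lattice L] (c : LatticeCon L) : Lattice c.Quot :=
  letI : Max c.Quot := ⟨Quotient.map₂ (sa := c.toSetoid) (sb := c.toSetoid) (sc := c.toSetoid)
    (fun a b => a ⊔ b) fun _ _ h _ _ h' => c.sup h h'⟩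
  letI : Min c.Quot := ⟨Quotient.map₂ (sa := c.toSetoid) (sb := c.toSetoid) (sc := c.toSetoid)
    (fun a b => a ⊓ b) fun _ _ h _ _ h' => c.inf h h'⟩
  Lattice.mk'
    (by rintro ⟨a⟩ ⟨b⟩; exact congrArg c.toQuot (sup_comm a b))
    (by rintro ⟨a⟩ ⟨b⟩ ⟨d⟩; exact congrArg c.toQuot (sup_assoc a b d))
    (by rintro ⟨a⟩ ⟨b⟩; exact congrArg c.toQuot (inf_comm a b))
    (by rintro ⟨a⟩ ⟨b⟩ ⟨d⟩; exact congrArg c.toQuot (inf_assoc a b d))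
    (by rintro ⟨a⟩ ⟨b⟩; exact congrArg c.toQuot sup_inf_self)
    (by rintro ⟨a⟩ ⟨b⟩; exact congrArg c.toQuot inf_sup_self)

/-- The smallest lattice congruence containing a relation. -/
def LatticeCon.gen {L : Type u} [Lattice L] (r : L → L → Prop) : LatticeCon L where
  r a b := ∀ c : LatticeCon L, (∀ x y, r x y → c.r x y) → c.r a b
  iseqv := ⟨fun a c _ => c.refl a, fun h c hc => c.symm (h c hc),
    fun h h' c hc => c.trans (h c hc) (h' c hc)⟩
  inf h h' c hc := c.inf (h c hc) (h' c hc)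
  sup h h' c hc := c.sup (h c hc) (h' c hc)

/-- A class of lattices closed under (non-empty) sublattices and quotient lattices; in particular
it is closed under isomorphism. -/
structure IsClosedLatticeClass (𝓛 : Set Lat.{u}) : Prop where
  sublattice : ∀ (L : Lat.{u}) (K : Sublattice L), (K : Set L).Nonempty → L ∈ 𝓛 → Lat.of K ∈ 𝓛
  quotient : ∀ (L K : Lat.{u}) (f : LatticeHom L K), Function.Surjective f → L ∈ 𝓛 → K ∈ 𝓛

/-- Collapse once more: the congruence on `L` generated by `c` together with all the pairs
`a ≤ b` for which the interval `[a, b]` of the quotient lattice `L / c` belongs to `𝓛`. -/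
def collapse (𝓛 : Set Lat.{u}) {L : Type u} [Lattice L] (c : LatticeCon L) : LatticeCon L :=
  LatticeCon.gen fun a b => c.r a b ∨
    (c.toQuot a ≤ c.toQuot b ∧ Lat.of (Set.Icc (c.toQuot a) (c.toQuot b)) ∈ 𝓛)

/-- The congruence `∼_α` on `L` which results from collapsing intervals in `𝓛` iteratively `α`
times: `∼_0` is equality, one collapses once more at successors, and at limits one takes the
congruence generated by the previous ones (which is their union). -/
def collapseIter (𝓛 : Set Lat.{u}) (L : Type u) [Lattice L] (α : Ordinal.{u}) : LatticeCon L :=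
  Ordinal.limitRecOn α (LatticeCon.gen fun a b => a = b) (fun _ c => collapse 𝓛 c)
    (fun β _ c => LatticeCon.gen fun a b => ∃ γ, ∃ h : γ < β, (c γ h).r a b)

open Classical in
/-- The `𝓛`-dimension of `L`: it is `-1` (written `⊥`) for the one element lattice, otherwise the
least ordinal `α` such that `L / ∼_(α+1)` is the one element lattice, and `⊤` ("does not exist") if
there is no such `α`. -/
def latticeDim (𝓛 : Set Lat.{u}) (L : Type u) [Lattice L] : WithTop (WithBot Ordinal.{u}) :=
  if Subsingleton L then ((⊥ : WithBot Ordinal.{u}) : WithTop (WithBot Ordinal.{u}))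
  else if ∃ α : Ordinal.{u}, ∀ a b, (collapseIter 𝓛 L (α + 1)).r a b then
    ((sInf {α : Ordinal.{u} | ∀ a b, (collapseIter 𝓛 L (α + 1)).r a b} : Ordinal.{u}) :
      WithBot Ordinal.{u})
  else ⊤

/-- `α + 1 + β` for ordinals or `-1 = ⊥`, where `-1 + 1 + β = β` and `α + 1 + (-1) = α`. -/
def addOneAdd : WithBot Ordinal.{u} → WithBot Ordinal.{u} → WithBot Ordinal.{u}
  | .none, b => b
  | .some α, .none => WithBot.some α
  | .some α, .some β => WithBot.some (α + 1 + β)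

/-- `d + 1 + d'` for dimensions; it does not exist if `d` or `d'` does not. -/
def dimAddOneAdd (d d' : WithTop (WithBot Ordinal.{u})) : WithTop (WithBot Ordinal.{u}) :=
  WithTop.map₂ addOneAdd d d'

end

/-!
The proof compares the lattices of pp-formulas in four steps.

*Lattices.* In a modular lattice perspective intervals are isomorphic, so collapsing the intervals
in `𝓛` identifies exactly the elements joined by finite chains of such intervals
(`collapse_r_iff`). Hence the iterated collapse is compatible with quotient maps and convex
embeddings (`IntervalSurjective.collapseIter_map`), convex embeddings into modular lattices reflect
it (`IntervalSurjective.collapseIter_of_map`), and collapsing in a quotient whose kernel is already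
collapsed costs as many steps as the ordinal sum says (`collapseIter_add_of_surjective`).

*Compactness.* Products and reduced products show that sets of pp-conditions and negated
pp-conditions which are finitely realized in a definable subcategory are realized in it
(`IsDefinable.exists_realization`). It follows that a definable subcategory is determined by the
implications between pp-formulas valid in it (`IsDefinable.mem_of_le`). In particular, it contains
with `M` the double character module of `M`, which is a compact topological module in which `M` is
pure; compact modules are pure-injective by Tychonoff's theorem, and `I` carries them to
algebraically compact modules (`Interpretation.algCompact`).

*The target as an interval.* Let `I` be given by the pp-pair `φ / ψ` in `m` variables. A formula `σ`
over the second ring pulls back to a formula `σ*` between `ψ` and `φ`. Fullness on pure-injectives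
makes every formula between `ψ` and `φ` of this form (`Interpretation.exists_star_eq`), since
otherwise there would be a homomorphism between algebraically compact modules `I M` and `I N` which
does not respect it. So the lattice over `D` is the interval between `ψ` and `φ` in the lattice
of pp-formulas in `m` variables over `C`. The latter collapses as soon as the lattice in one
variable does (`Collapses.of_one`), and the lower bound follows.

*The kernel.* If `φ` and `ψ` are identified after `γ` steps, then so are any two formulas over `C`
which agree on `ker I` (`collapse_of_le_on_closed`): from a generic element of `σ` one obtains, by
moving `φ` into `ψ` again and again, an element of a module in `ker I` whose pp-type is still
what `σ` implies modulo the congruence. So the lattice of `ker I` has the `γ`-fold collapse of the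
lattice over `C` as a quotient, and the upper bound follows.
-/

/-! ### Lattice congruences and their quotients -/

namespace LatticeCon

variable {L K : Type u} [Lattice L] [Lattice K]

theorem toQuot_eq {c : LatticeCon L} {a b : L} : c.toQuot a = c.toQuot b ↔ c.r a b :=
  Quotient.eq (r := c.toSetoid)

theorem toQuot_surjective (c : LatticeCon L) : Function.Surjective c.toQuot :=
  Quotient.mk_surjective (s := c.toSetoid)

/-- The quotient map as a lattice homomorphism. -/
def toQuotHom (c : LatticeCon L) : LatticeHom L c.Quot where
  toFun := c.toQuot
  map_sup' _ _ := rfl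
  map_inf' _ _ := rfl

@[simp] theorem toQuotHom_apply (c : LatticeCon L) (a : L) : c.toQuotHom a = c.toQuot a := rfl

theorem toQuot_sup (c : LatticeCon L) (a b : L) :
    c.toQuot (a ⊔ b) = c.toQuot a ⊔ c.toQuot b := rfl

theorem toQuot_inf (c : LatticeCon L) (a b : L) :
    c.toQuot (a ⊓ b) = c.toQuot a ⊓ c.toQuot b := rfl

theorem toQuot_mono (c : LatticeCon L) : Monotone c.toQuot :=
  OrderHomClass.mono c.toQuotHom

theorem gen_of {r : L → L → Prop} {a b : L} (h : r a b) : (gen r).r a b :=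
  fun _ hc => hc _ _ h

theorem gen_le {r : L → L → Prop} {c : LatticeCon L} (hc : ∀ x y, r x y → c.r x y) {a b : L}
    (h : (gen r).r a b) : c.r a b :=
  h c hc

/-- The preimage of a congruence under a lattice homomorphism. -/
def comap (f : LatticeHom L K) (c : LatticeCon K) : LatticeCon L where
  r a b := c.r (f a) (f b)
  iseqv := ⟨fun _ => c.refl _, fun h => c.symm h, fun h h' => c.trans h h'⟩
  inf h h' := by simpa using c.inf h h'
  sup h h' := by simpa using c.sup h h'

theorem comap_r (f : LatticeHom L K) (c : LatticeCon K) (a b : L) :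
    (comap f c).r a b ↔ c.r (f a) (f b) := Iff.rfl

/-- A lattice homomorphism which respects congruences induces a homomorphism of the quotients. -/
def mapQuot (f : LatticeHom L K) (c : LatticeCon L) (d : LatticeCon K)
    (h : ∀ a b, c.r a b → d.r (f a) (f b)) : LatticeHom c.Quot d.Quot where
  toFun := Quotient.map (sa := c.toSetoid) (sb := d.toSetoid) f h
  map_sup' := by
    rintro ⟨a⟩ ⟨b⟩
    exact congrArg d.toQuot (map_sup f a b)
  map_inf' := by
    rintro ⟨a⟩ ⟨b⟩
    exact congrArg d.toQuot (map_inf f a b)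

theorem mapQuot_toQuot (f : LatticeHom L K) (c : LatticeCon L) (d : LatticeCon K)
    (h : ∀ a b, c.r a b → d.r (f a) (f b)) (a : L) :
    mapQuot f c d h (c.toQuot a) = d.toQuot (f a) := rfl

instance [IsModularLattice L] (c : LatticeCon L) : IsModularLattice c.Quot where
  sup_inf_le_assoc_of_le := by
    intro x y z hxz
    obtain ⟨x, rfl⟩ := c.toQuot_surjective x
    obtain ⟨y, rfl⟩ := c.toQuot_surjective y
    obtain ⟨z, rfl⟩ := c.toQuot_surjective z
    rw [← sup_eq_right, ← toQuot_sup] at hxz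
    rw [← hxz, ← toQuot_sup, ← toQuot_inf, ← toQuot_inf, ← toQuot_sup]
    exact c.toQuot_mono (sup_inf_le_assoc_of_le y le_sup_left)

end LatticeCon

/-- A lattice homomorphism which maps every interval `[a, b]` onto the interval `[f a, f b]`.
Surjective homomorphisms and embeddings with convex image are the examples that matter. -/
def IntervalSurjective {L K : Type u} [Lattice L] [Lattice K] (f : LatticeHom L K) : Prop :=
  ∀ ⦃a b : L⦄ ⦃y : K⦄, a ≤ b → f a ≤ y → y ≤ f b → ∃ x, a ≤ x ∧ x ≤ b ∧ f x = y

section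

variable {L K : Type u} [Lattice L] [Lattice K]

theorem intervalSurjective_of_surjective {f : LatticeHom L K} (hf : Function.Surjective f) :
    IntervalSurjective f := by
  intro a b y hab hay hyb
  obtain ⟨x, rfl⟩ := hf y
  refine ⟨(x ⊔ a) ⊓ b, le_inf le_sup_right hab, inf_le_right, ?_⟩
  rw [map_inf, map_sup, sup_eq_left.2 hay, inf_eq_left.2 hyb]

/-- An embedding is interval-surjective as soon as its image is convex. -/
theorem intervalSurjective_of_convex {f : LatticeHom L K} (hf : Function.Injective f)
    (h : ∀ a b y, f a ≤ y → y ≤ f b → ∃ x, f x = y) : IntervalSurjective f := by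
  intro a b y _ hay hyb
  obtain ⟨x, rfl⟩ := h a b y hay hyb
  refine ⟨x, ?_, ?_, rfl⟩
  · rw [← sup_eq_right] at hay ⊢
    exact hf (by rw [map_sup, hay])
  · rw [← sup_eq_right] at hyb ⊢
    exact hf (by rw [map_sup, hyb])

theorem IntervalSurjective.mapQuot {f : LatticeHom L K} (hf : IntervalSurjective f)
    {c : LatticeCon L} {d : LatticeCon K} (h : ∀ a b, c.r a b → d.r (f a) (f b)) :
    IntervalSurjective (LatticeCon.mapQuot f c d h) := by
  intro a b y hab hay hyb
  obtain ⟨a, rfl⟩ := c.toQuot_surjective a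
  obtain ⟨b, rfl⟩ := c.toQuot_surjective b
  obtain ⟨y, rfl⟩ := d.toQuot_surjective y
  rw [LatticeCon.mapQuot_toQuot] at hay hyb
  have hb : c.toQuot (a ⊔ b) = c.toQuot b := by rw [LatticeCon.toQuot_sup, sup_eq_right.2 hab]
  have hfb : d.toQuot (f (a ⊔ b)) = d.toQuot (f b) := by
    rw [LatticeCon.toQuot_eq] at hb ⊢
    exact h _ _ hb
  obtain ⟨x, hax, hxb, hx⟩ := hf (a := a) (b := a ⊔ b) (y := (y ⊔ f a) ⊓ f (a ⊔ b)) le_sup_left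
    (le_inf le_sup_right (OrderHomClass.mono f le_sup_left)) inf_le_right
  refine ⟨c.toQuot x, c.toQuot_mono hax, hb ▸ c.toQuot_mono hxb, ?_⟩
  rw [LatticeCon.mapQuot_toQuot, hx, LatticeCon.toQuot_inf, LatticeCon.toQuot_sup, hfb,
    sup_eq_left.2 hay, inf_eq_left.2 hyb]

/-- The homomorphism of intervals induced by a lattice homomorphism. -/
def LatticeHom.mapIcc (f : LatticeHom L K) (a b : L) :
    LatticeHom (Set.Icc a b) (Set.Icc (f a) (f b)) where
  toFun x := ⟨f x, OrderHomClass.mono f x.2.1, OrderHomClass.mono f x.2.2⟩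
  map_sup' x y := Subtype.ext (map_sup f x.1 y.1)
  map_inf' x y := Subtype.ext (map_inf f x.1 y.1)

end

/-! ### Collapsing intervals in modular lattices -/

namespace IsClosedLatticeClass

variable {𝓛 : Set Lat.{u}} (h𝓛 : IsClosedLatticeClass 𝓛)
  {L K : Type u} [Lattice L] [Lattice K]

include h𝓛

theorem of_surjective (f : LatticeHom L K) (hf : Function.Surjective f) (h : Lat.of L ∈ 𝓛) :
    Lat.of K ∈ 𝓛 :=
  h𝓛.quotient (Lat.of L) (Lat.of K) f hf h

theorem of_injective [Nonempty K] (f : LatticeHom K L) (hf : Function.Injective f)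
    (h : Lat.of L ∈ 𝓛) : Lat.of K ∈ 𝓛 := by
  let S : Sublattice L :=
    { carrier := Set.range f
      supClosed' := by
        rintro _ ⟨a, rfl⟩ _ ⟨b, rfl⟩
        exact ⟨a ⊔ b, map_sup f a b⟩
      infClosed' := by
        rintro _ ⟨a, rfl⟩ _ ⟨b, rfl⟩
        exact ⟨a ⊓ b, map_inf f a b⟩ }
  have hS : Lat.of S ∈ 𝓛 := h𝓛.sublattice (Lat.of L) S (Set.range_nonempty f) h
  have hinv : ∀ s : S, f s.2.choose = s.1 := fun s => s.2.choose_spec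
  refine h𝓛.of_surjective (L := S)
    { toFun := fun s => s.2.choose
      map_sup' := fun s t => hf ?_
      map_inf' := fun s t => hf ?_ } (fun a => ⟨⟨f a, a, rfl⟩, hf (hinv _)⟩) hS
  · rw [map_sup, hinv, hinv, hinv]; rfl
  · rw [map_inf, hinv, hinv, hinv]; rfl

theorem Icc_map {f : LatticeHom L K} (hf : IntervalSurjective f) {a b : L} (hab : a ≤ b)
    (h : Lat.of (Set.Icc a b) ∈ 𝓛) : Lat.of (Set.Icc (f a) (f b)) ∈ 𝓛 := by
  refine h𝓛.of_surjective (LatticeHom.mapIcc f a b) ?_ h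
  rintro ⟨y, hy⟩
  obtain ⟨x, h1, h2, rfl⟩ := hf hab hy.1 hy.2
  exact ⟨⟨x, h1, h2⟩, rfl⟩

theorem Icc_of_map {f : LatticeHom L K} (hf : Function.Injective f) {a b : L} (hab : a ≤ b)
    (h : Lat.of (Set.Icc (f a) (f b)) ∈ 𝓛) : Lat.of (Set.Icc a b) ∈ 𝓛 := by
  have : Nonempty (Set.Icc a b) := ⟨⟨a, le_rfl, hab⟩⟩
  exact h𝓛.of_injective (LatticeHom.mapIcc f a b)
    (fun x y hxy => Subtype.ext (hf (congrArg Subtype.val hxy))) h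

theorem Icc_mono {a b a' b' : L} (ha : a ≤ a') (hab : a' ≤ b') (hb : b' ≤ b)
    (h : Lat.of (Set.Icc a b) ∈ 𝓛) : Lat.of (Set.Icc a' b') ∈ 𝓛 := by
  have : Nonempty (Set.Icc a' b') := ⟨⟨a', le_rfl, hab⟩⟩
  exact h𝓛.of_injective (K := Set.Icc a' b') (L := Set.Icc a b)
    { toFun := fun x => ⟨x, ha.trans x.2.1, x.2.2.trans hb⟩
      map_sup' := fun _ _ => rfl
      map_inf' := fun _ _ => rfl }
    (fun x y hxy => Subtype.ext (Subtype.ext_iff.1 hxy :)) h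

theorem of_orderIso (e : L ≃o K) (h : Lat.of L ∈ 𝓛) : Lat.of K ∈ 𝓛 :=
  h𝓛.of_surjective
    { toFun := e, map_sup' := fun a b => map_sup e a b, map_inf' := fun a b => map_inf e a b }
    e.surjective h

end IsClosedLatticeClass

/-- A single collapsed interval: `a ≤ b` and `[a, b]` belongs to `𝓛`. -/
def CollapseStep (𝓛 : Set Lat.{u}) {L : Type u} [Lattice L] (a b : L) : Prop :=
  a ≤ b ∧ Lat.of (Set.Icc a b) ∈ 𝓛

/-- There is a finite chain from `a` up to `b` all of whose steps are intervals in `𝓛`. -/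
abbrev CollapseChain (𝓛 : Set Lat.{u}) {L : Type u} [Lattice L] : L → L → Prop :=
  Relation.ReflTransGen (CollapseStep 𝓛)

section

variable {𝓛 : Set Lat.{u}} {L K : Type u} [Lattice L] [Lattice K]

theorem CollapseChain.le {a b : L} (h : CollapseChain 𝓛 a b) : a ≤ b := by
  induction h with
  | refl => exact le_rfl
  | tail _ hs ih => exact ih.trans hs.1

/-- The interval from `a ⊓ t` to `b ⊓ t` is perspective to the subinterval from `a` to
`a ⊔ b ⊓ t` of the given one. -/
theorem CollapseStep.inf [IsModularLattice L] (h𝓛 : IsClosedLatticeClass 𝓛) {a b : L}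
    (h : CollapseStep 𝓛 a b) (t : L) : CollapseStep 𝓛 (a ⊓ t) (b ⊓ t) := by
  refine ⟨inf_le_inf_right t h.1, ?_⟩
  have e := infIccOrderIsoIccSup (b ⊓ t) a
  have h1 : b ⊓ t ⊓ a = a ⊓ t := by
    rw [inf_right_comm, inf_eq_right.2 h.1]
  rw [h1] at e
  refine h𝓛.of_orderIso e.symm (h𝓛.Icc_mono le_rfl le_sup_right ?_ h.2)
  exact sup_le inf_le_left h.1

theorem CollapseStep.sup [IsModularLattice L] (h𝓛 : IsClosedLatticeClass 𝓛) {a b : L}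
    (h : CollapseStep 𝓛 a b) (t : L) : CollapseStep 𝓛 (a ⊔ t) (b ⊔ t) := by
  refine ⟨sup_le_sup_right h.1 t, ?_⟩
  have e := infIccOrderIsoIccSup b (a ⊔ t)
  have h1 : b ⊔ (a ⊔ t) = b ⊔ t := by
    rw [← sup_assoc, sup_eq_left.2 h.1]
  rw [h1] at e
  refine h𝓛.of_orderIso e (h𝓛.Icc_mono ?_ inf_le_left le_rfl h.2)
  exact le_inf h.1 le_sup_left

/-- In a modular lattice the chains of intervals in `𝓛` already describe a congruence, because
perspective intervals are isomorphic. -/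
def chainCon [IsModularLattice L] (h𝓛 : IsClosedLatticeClass 𝓛) : LatticeCon L :=
  haveI : Std.Refl (fun x y : L => CollapseChain 𝓛 (x ⊓ y) (x ⊔ y)) :=
    ⟨fun x => by simpa using Relation.ReflTransGen.refl⟩
  LatticeCon.mk' (fun x y => CollapseChain 𝓛 (x ⊓ y) (x ⊔ y))
    (fun x y => by
      rw [inf_eq_left.2 (inf_le_sup : x ⊓ y ≤ x ⊔ y), sup_eq_right.2 (inf_le_sup : x ⊓ y ≤ x ⊔ y)])
    (fun x y z hxy hyz h h' => by
      rw [inf_eq_left.2 hxy, sup_eq_right.2 hxy] at h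
      rw [inf_eq_left.2 hyz, sup_eq_right.2 hyz] at h'
      rw [inf_eq_left.2 (hxy.trans hyz), sup_eq_right.2 (hxy.trans hyz)]
      exact h.trans h')
    (fun x y t hxy h => by
      rw [inf_eq_left.2 hxy, sup_eq_right.2 hxy] at h
      rw [inf_eq_left.2 (inf_le_inf_right t hxy), sup_eq_right.2 (inf_le_inf_right t hxy),
        inf_eq_left.2 (sup_le_sup_right hxy t), sup_eq_right.2 (sup_le_sup_right hxy t)]
      exact ⟨Relation.ReflTransGen.lift (fun a => a ⊓ t)
          (fun a b (hs : CollapseStep 𝓛 a b) => hs.inf h𝓛 t) _ _ h,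
        Relation.ReflTransGen.lift (fun a => a ⊔ t)
          (fun a b (hs : CollapseStep 𝓛 a b) => hs.sup h𝓛 t) _ _ h⟩)

theorem chainCon_r [IsModularLattice L] (h𝓛 : IsClosedLatticeClass 𝓛) {a b : L} :
    (chainCon h𝓛 : LatticeCon L).r a b ↔ CollapseChain 𝓛 (a ⊓ b) (a ⊔ b) := Iff.rfl

theorem le_collapse {c : LatticeCon L} {a b : L} (h : c.r a b) : (collapse 𝓛 c).r a b :=
  LatticeCon.gen_of (Or.inl h)

theorem collapse_of_chain {c : LatticeCon L} {x y : c.Quot} (h : CollapseChain 𝓛 x y) :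
    ∀ a b, c.toQuot a = x → c.toQuot b = y → (collapse 𝓛 c).r a b := by
  induction h with
  | refl =>
    rintro a b h1 h2
    exact le_collapse (LatticeCon.toQuot_eq.1 (h1.trans h2.symm))
  | @tail z _ _ hs ih =>
    rintro a b h1 rfl
    obtain ⟨d, rfl⟩ := c.toQuot_surjective z
    exact (collapse 𝓛 c).trans (ih a d h1 rfl) (LatticeCon.gen_of (Or.inr hs))

/-- Collapsing once more means collapsing the chains in the quotient lattice. -/
theorem collapse_r_iff [IsModularLattice L] (h𝓛 : IsClosedLatticeClass 𝓛) {c : LatticeCon L}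
    {a b : L} : (collapse 𝓛 c).r a b ↔
      CollapseChain 𝓛 (c.toQuot (a ⊓ b)) (c.toQuot (a ⊔ b)) := by
  constructor
  · intro h
    refine LatticeCon.gen_le (c := LatticeCon.comap c.toQuotHom (chainCon h𝓛)) ?_ h
    rintro x y (hxy | hxy)
    · rw [LatticeCon.comap_r, LatticeCon.toQuotHom_apply, LatticeCon.toQuotHom_apply,
        LatticeCon.toQuot_eq.2 hxy]
    · rw [LatticeCon.comap_r, chainCon_r, LatticeCon.toQuotHom_apply, LatticeCon.toQuotHom_apply,
        inf_eq_left.2 hxy.1, sup_eq_right.2 hxy.1]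
      exact Relation.ReflTransGen.single hxy
  · intro h
    exact (LatticeCon.r_inf_sup_iff _).1 (collapse_of_chain h _ _ rfl rfl)

/-! ### The iterated collapse -/

variable (𝓛 L) in
theorem collapseIter_zero {a b : L} : (collapseIter 𝓛 L 0).r a b ↔ a = b := by
  rw [collapseIter, Ordinal.limitRecOn_zero]
  constructor
  · intro h
    exact LatticeCon.gen_le (c := LatticeCon.ker (LatticeHom.id L)) (fun x y hxy => hxy) h
  · rintro rfl
    exact Setoid.refl' _ _

variable (𝓛 L) in
theorem collapseIter_add_one (α : Ordinal.{u}) :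
    collapseIter 𝓛 L (α + 1) = collapse 𝓛 (collapseIter 𝓛 L α) := by
  rw [collapseIter, Ordinal.limitRecOn_add_one]
  rfl

variable (𝓛 L) in
theorem collapseIter_limit' {α : Ordinal.{u}} (hα : Order.IsSuccLimit α) :
    collapseIter 𝓛 L α =
      LatticeCon.gen fun a b => ∃ γ, ∃ _ : γ < α, (collapseIter 𝓛 L γ).r a b := by
  rw [collapseIter, Ordinal.limitRecOn_limit _ _ _ _ hα]
  rfl

theorem collapseIter_mono {α β : Ordinal.{u}} (h : α ≤ β) {a b : L}
    (hab : (collapseIter 𝓛 L α).r a b) : (collapseIter 𝓛 L β).r a b := by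
  induction β using Ordinal.limitRecOn with
  | zero =>
    obtain rfl : α = 0 := by simpa using h
    exact hab
  | add_one β ih =>
    rcases h.lt_or_eq with h | rfl
    · rw [collapseIter_add_one]
      exact le_collapse (ih (Order.lt_add_one_iff.1 h))
    · exact hab
  | limit β hβ ih =>
    rcases h.lt_or_eq with h | rfl
    · rw [collapseIter_limit' 𝓛 L hβ]
      exact LatticeCon.gen_of ⟨α, h, hab⟩
    · exact hab

/-- At a limit ordinal the iterated collapse is the union of the previous ones. -/
theorem collapseIter_limit {α : Ordinal.{u}} (hα : Order.IsSuccLimit α) {a b : L} :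
    (collapseIter 𝓛 L α).r a b ↔ ∃ γ < α, (collapseIter 𝓛 L γ).r a b := by
  constructor
  · rw [collapseIter_limit' 𝓛 L hα]
    have h0 : 0 < α := hα.bot_lt
    let U : LatticeCon L :=
      { r := fun a b => ∃ γ < α, (collapseIter 𝓛 L γ).r a b
        iseqv := ⟨fun x => ⟨0, h0, Setoid.refl' _ _⟩,
          fun ⟨γ, hγ, h⟩ => ⟨γ, hγ, Setoid.symm' _ h⟩,
          fun ⟨γ, hγ, h⟩ ⟨δ, hδ, h'⟩ => ⟨max γ δ, max_lt hγ hδ,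
            Setoid.trans' _ (collapseIter_mono (le_max_left _ _) h)
              (collapseIter_mono (le_max_right _ _) h')⟩⟩
        inf := fun ⟨γ, hγ, h⟩ ⟨δ, hδ, h'⟩ => ⟨max γ δ, max_lt hγ hδ,
            LatticeCon.inf _ (collapseIter_mono (le_max_left _ _) h)
              (collapseIter_mono (le_max_right _ _) h')⟩
        sup := fun ⟨γ, hγ, h⟩ ⟨δ, hδ, h'⟩ => ⟨max γ δ, max_lt hγ hδ,
            LatticeCon.sup _ (collapseIter_mono (le_max_left _ _) h)
              (collapseIter_mono (le_max_right _ _) h')⟩ }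
    exact LatticeCon.gen_le (c := U) fun x y ⟨γ, hγ, h⟩ => ⟨γ, hγ, h⟩
  · rintro ⟨γ, hγ, h⟩
    exact collapseIter_mono hγ.le h

theorem IntervalSurjective.collapse_map (h𝓛 : IsClosedLatticeClass 𝓛) {f : LatticeHom L K}
    (hf : IntervalSurjective f) {c : LatticeCon L} {d : LatticeCon K}
    (hcd : ∀ a b, c.r a b → d.r (f a) (f b)) {a b : L} (h : (collapse 𝓛 c).r a b) :
    (collapse 𝓛 d).r (f a) (f b) := by
  refine LatticeCon.gen_le (c := LatticeCon.comap f (collapse 𝓛 d)) ?_ h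
  rintro x y (hxy | ⟨hxy, hI⟩)
  · exact le_collapse (hcd _ _ hxy)
  · refine LatticeCon.gen_of (Or.inr ⟨?_, ?_⟩)
    · exact OrderHomClass.mono (LatticeCon.mapQuot f c d hcd) hxy
    · exact h𝓛.Icc_map (hf.mapQuot hcd) hxy hI

/-- Interval-surjective homomorphisms, in particular quotient maps and convex embeddings, are
compatible with the iterated collapse. -/
theorem IntervalSurjective.collapseIter_map (h𝓛 : IsClosedLatticeClass 𝓛) {f : LatticeHom L K}
    (hf : IntervalSurjective f) {α : Ordinal.{u}} {a b : L} (h : (collapseIter 𝓛 L α).r a b) :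
    (collapseIter 𝓛 K α).r (f a) (f b) := by
  induction α using Ordinal.limitRecOn generalizing a b with
  | zero =>
    rw [collapseIter_zero] at h ⊢
    rw [h]
  | add_one α ih =>
    rw [collapseIter_add_one] at h ⊢
    exact hf.collapse_map h𝓛 (fun _ _ => ih) h
  | limit α hα ih =>
    rw [collapseIter_limit hα] at h ⊢
    obtain ⟨γ, hγ, h⟩ := h
    exact ⟨γ, hγ, ih γ hγ h⟩

theorem CollapseChain.of_map (h𝓛 : IsClosedLatticeClass 𝓛) {f : LatticeHom L K}
    (hf : IntervalSurjective f) (hinj : Function.Injective f) {x y : K}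
    (h : CollapseChain 𝓛 x y) : ∀ a b : L, a ≤ b → f a = x → f b = y → CollapseChain 𝓛 a b := by
  induction h with
  | refl =>
    rintro a b _ h1 h2
    rw [hinj (h1.trans h2.symm)]
  | tail hc hs ih =>
    rintro a b hab rfl rfl
    obtain ⟨z, haz, hzb, rfl⟩ := hf hab (CollapseChain.le hc) hs.1
    exact (ih a z haz rfl rfl).tail ⟨hzb, h𝓛.Icc_of_map hinj hzb hs.2⟩

/-- Embeddings with convex image into modular lattices reflect the iterated collapse. -/
theorem IntervalSurjective.collapseIter_of_map [IsModularLattice L] [IsModularLattice K]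
    (h𝓛 : IsClosedLatticeClass 𝓛) {f : LatticeHom L K} (hf : IntervalSurjective f)
    (hinj : Function.Injective f) {α : Ordinal.{u}} {a b : L}
    (h : (collapseIter 𝓛 K α).r (f a) (f b)) : (collapseIter 𝓛 L α).r a b := by
  induction α using Ordinal.limitRecOn generalizing a b with
  | zero =>
    rw [collapseIter_zero] at h ⊢
    exact hinj h
  | add_one α ih =>
    rw [collapseIter_add_one, collapse_r_iff h𝓛] at h ⊢
    rw [← map_inf, ← map_sup] at h
    refine h.of_map h𝓛 (f := LatticeCon.mapQuot f (collapseIter 𝓛 L α) (collapseIter 𝓛 K α)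
      fun _ _ => hf.collapseIter_map h𝓛) (hf.mapQuot _) ?_ _ _ ?_ rfl rfl
    · intro x y hxy
      obtain ⟨x, rfl⟩ := LatticeCon.toQuot_surjective _ x
      obtain ⟨y, rfl⟩ := LatticeCon.toQuot_surjective _ y
      rw [LatticeCon.mapQuot_toQuot, LatticeCon.mapQuot_toQuot, LatticeCon.toQuot_eq] at hxy
      exact LatticeCon.toQuot_eq.2 (ih hxy)
    · exact LatticeCon.toQuot_mono _ inf_le_sup
  | limit α hα ih =>
    rw [collapseIter_limit hα] at h ⊢
    obtain ⟨γ, hγ, h⟩ := h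
    exact ⟨γ, hγ, ih γ hγ h⟩

/-- If the kernel of a quotient map `f : L → K` is collapsed after `γ` steps, then what is collapsed
in `K` after `β` further steps is collapsed in `L` after `γ + β` steps. -/
theorem collapseIter_add_of_surjective (h𝓛 : IsClosedLatticeClass 𝓛) {f : LatticeHom L K}
    (hf : Function.Surjective f) {γ : Ordinal.{u}}
    (hker : ∀ a b, f a = f b → (collapseIter 𝓛 L γ).r a b) {β : Ordinal.{u}} {a b : L}
    (h : (collapseIter 𝓛 K β).r (f a) (f b)) : (collapseIter 𝓛 L (γ + β)).r a b := by
  induction β using Ordinal.limitRecOn generalizing a b with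
  | zero =>
    rw [collapseIter_zero] at h
    rw [add_zero]
    exact hker a b h
  | add_one β ih =>
    rw [← add_assoc, collapseIter_add_one]
    rw [collapseIter_add_one] at h
    set c := collapseIter 𝓛 L (γ + β)
    set d := collapseIter 𝓛 K β
    have hker' : ∀ x y, f x = f y → c.r x y := fun x y hxy =>
      ih (by rw [hxy])
    choose s hs using hf
    -- the quotient map `L → L / c` factors through `f`
    let g : LatticeHom K c.Quot :=
      { toFun := fun x => c.toQuot (s x)
        map_sup' := fun x y => by
          rw [← LatticeCon.toQuot_sup, LatticeCon.toQuot_eq]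
          exact hker' _ _ (by rw [map_sup, hs, hs, hs])
        map_inf' := fun x y => by
          rw [← LatticeCon.toQuot_inf, LatticeCon.toQuot_eq]
          exact hker' _ _ (by rw [map_inf, hs, hs, hs]) }
    have hg : ∀ x, g (f x) = c.toQuot x := fun x => LatticeCon.toQuot_eq.2 (hker' _ _ (hs _))
    -- the image of the congruence `collapse 𝓛 c` in `K`
    let e : LatticeCon K :=
      { r := fun x y => (collapse 𝓛 c).r (s x) (s y)
        iseqv := ⟨fun _ => Setoid.refl' _ _, fun h => Setoid.symm' _ h,
          fun h h' => Setoid.trans' _ h h'⟩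
        inf := fun {w x y z} h h' => Setoid.trans' _ (Setoid.trans' _
          (le_collapse (hker' _ (s w ⊓ s y) (by rw [map_inf, hs, hs, hs]))) (LatticeCon.inf _ h h'))
          (le_collapse (hker' (s x ⊓ s z) _ (by rw [map_inf, hs, hs, hs])))
        sup := fun {w x y z} h h' => Setoid.trans' _ (Setoid.trans' _
          (le_collapse (hker' _ (s w ⊔ s y) (by rw [map_sup, hs, hs, hs]))) (LatticeCon.sup _ h h'))
          (le_collapse (hker' (s x ⊔ s z) _ (by rw [map_sup, hs, hs, hs]))) }
    have hgd : ∀ x y, d.r x y → c.r (s x) (s y) := fun x y hxy =>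
      ih (by rw [hs, hs]; exact hxy)
    let G : LatticeHom d.Quot c.Quot :=
      { toFun := Quotient.lift (s := d.toSetoid) g
          fun x y hxy => LatticeCon.toQuot_eq.2 (hgd x y hxy)
        map_sup' := by
          rintro ⟨x⟩ ⟨y⟩
          exact map_sup g x y
        map_inf' := by
          rintro ⟨x⟩ ⟨y⟩
          exact map_inf g x y }
    have hG : ∀ x, G (d.toQuot x) = c.toQuot (s x) := fun x => rfl
    have hGsurj : Function.Surjective G := by
      intro y
      obtain ⟨y, rfl⟩ := c.toQuot_surjective y
      exact ⟨d.toQuot (f y), hg y⟩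
    have key : e.r (f a) (f b) := by
      refine LatticeCon.gen_le (c := e) ?_ h
      rintro x y (hxy | ⟨hxy, hI⟩)
      · exact le_collapse (hgd x y hxy)
      · refine LatticeCon.gen_of (Or.inr ⟨?_, ?_⟩)
        · exact OrderHomClass.mono G hxy
        · exact h𝓛.Icc_map (intervalSurjective_of_surjective hGsurj) hxy hI
    exact Setoid.trans' _ (Setoid.trans' _ (le_collapse (hker' a _ (hs (f a)).symm)) key)
      (le_collapse (hker' _ b (hs (f b))))
  | limit β hβ ih =>
    rw [collapseIter_limit hβ] at h
    obtain ⟨δ, hδ, h⟩ := h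
    exact collapseIter_mono (by gcongr) (ih δ hδ h)

/-! ### The dimension -/

/-- All of `L` is collapsed after `α` steps. -/
def Collapses (𝓛 : Set Lat.{u}) (L : Type u) [Lattice L] (α : Ordinal.{u}) : Prop :=
  ∀ a b, (collapseIter 𝓛 L α).r a b

theorem Collapses.mono {α β : Ordinal.{u}} (h : α ≤ β) (hα : Collapses 𝓛 L α) :
    Collapses 𝓛 L β :=
  fun a b => collapseIter_mono h (hα a b)

variable (𝓛 L) in
theorem collapses_zero_iff : Collapses 𝓛 L 0 ↔ Subsingleton L :=
  ⟨fun h => ⟨fun a b => (collapseIter_zero 𝓛 L).1 (h a b)⟩,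
    fun _ a b => (collapseIter_zero 𝓛 L).2 (Subsingleton.elim a b)⟩

/-- The number of collapses allowed by a bound on the dimension: none for `-1`, and `α + 1` for
the ordinal `α`. -/
def stepsOf : WithBot Ordinal.{u} → Ordinal.{u}
  | .none => 0
  | .some α => α + 1

theorem stepsOf_coe (α : Ordinal.{u}) : stepsOf (α : WithBot Ordinal.{u}) = α + 1 := rfl

theorem stepsOf_mono : Monotone stepsOf.{u} := by
  intro d d' h
  induction d using WithBot.recBotCoe with
  | bot => exact bot_le
  | coe α =>
    induction d' using WithBot.recBotCoe with
    | bot => simp at h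
    | coe β =>
      rw [stepsOf_coe, stepsOf_coe]
      gcongr
      exact WithBot.coe_le_coe.1 h

theorem stepsOf_addOneAdd (d d' : WithBot Ordinal.{u}) :
    stepsOf (addOneAdd d d') = stepsOf d + stepsOf d' := by
  induction d using WithBot.recBotCoe with
  | bot => exact (zero_add _).symm
  | coe α =>
    induction d' using WithBot.recBotCoe with
    | bot => exact (add_zero _).symm
    | coe β => exact add_assoc (α + 1) β 1

theorem latticeDim_le_iff {d : WithBot Ordinal.{u}} :
    latticeDim 𝓛 L ≤ d ↔ Collapses 𝓛 L (stepsOf d) := by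
  unfold latticeDim
  split_ifs with h1 h2
  · refine ⟨fun _ => ((collapses_zero_iff 𝓛 L).2 h1).mono bot_le, fun _ => ?_⟩
    exact WithTop.coe_le_coe.2 bot_le
  · have hmem := csInf_mem (s := {α : Ordinal.{u} | ∀ a b, (collapseIter 𝓛 L (α + 1)).r a b}) h2
    rw [WithTop.coe_le_coe]
    refine ⟨fun h => Collapses.mono (stepsOf_mono h) hmem, fun h => ?_⟩
    induction d using WithBot.recBotCoe with
    | bot => exact absurd ((collapses_zero_iff 𝓛 L).1 h) h1
    | coe α => exact WithBot.coe_le_coe.2 (csInf_le' h)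
  · refine ⟨fun h => absurd h (by simp), fun h => ?_⟩
    induction d using WithBot.recBotCoe with
    | bot => exact absurd ((collapses_zero_iff 𝓛 L).1 h) h1
    | coe α => exact absurd ⟨α, h⟩ h2

/-- A dimension is bounded by another one if every number of steps which collapses the second
lattice also collapses the first. -/
theorem latticeDim_le_latticeDim
    (h : ∀ γ : Ordinal.{u}, Collapses 𝓛 K γ → Collapses 𝓛 L γ) :
    latticeDim 𝓛 L ≤ latticeDim 𝓛 K := by
  cases hK : latticeDim 𝓛 K with
  | top => exact le_top
  | coe d => exact latticeDim_le_iff.2 (h _ (latticeDim_le_iff.1 hK.le))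

end

/-! ### pp-definable conditions -/

section PPDef

variable {A : Type u} [Ring A] {V W : Type*}

open Finsupp (linearCombination single)

/-- A condition on families `h : V → M` of elements of modules is pp-definable if it asks that
a finite system of homogeneous linear equations in the `h x` be solvable in finitely many further
unknowns. The index type `V` may be infinite, but only finitely many `h x` matter. -/
def PPDef (A : Type u) [Ring A] {V : Type*}
    (P : ∀ (M : Type u) [AddCommGroup M] [Module A M], (V → M) → Prop) : Prop :=
  ∃ (κ ι : Type) (_ : Fintype κ) (_ : Fintype ι) (B : ι → (V ⊕ κ) →₀ A),
    ∀ (M : Type u) [AddCommGroup M] [Module A M] (h : V → M),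
      P M h ↔ ∃ y : κ → M, ∀ j, linearCombination A (Sum.elim h y) (B j) = 0

namespace PPDef

variable {P Q : ∀ (M : Type u) [AddCommGroup M] [Module A M], (V → M) → Prop}

theorem congr (hP : PPDef A P)
    (h : ∀ (M : Type u) [AddCommGroup M] [Module A M] (h : V → M), Q M h ↔ P M h) : PPDef A Q := by
  obtain ⟨κ, ι, _, _, B, hB⟩ := hP
  exact ⟨κ, ι, inferInstance, inferInstance, B, fun M _ _ x => (h M x).trans (hB M x)⟩

/-- pp-definable conditions are closed under linear substitutions. -/
theorem subst {P : ∀ (M : Type u) [AddCommGroup M] [Module A M], (W → M) → Prop} (hP : PPDef A P)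
    (l : W → V →₀ A) :
    PPDef A fun M _ _ (h : V → M) => P M fun k => linearCombination A h (l k) := by
  obtain ⟨κ, ι, _, _, B, hB⟩ := hP
  refine ⟨κ, ι, inferInstance, inferInstance, fun j => linearCombination A (Sum.elim
    (fun k => (l k).mapDomain Sum.inl) (fun k => single (Sum.inr k) 1)) (B j), fun M _ _ h => ?_⟩
  beta_reduce
  rw [hB]
  refine exists_congr fun y => forall_congr' fun j => ?_
  rw [Finsupp.apply_linearCombination]
  have : (linearCombination A (Sum.elim h y)) ∘ Sum.elim
      (fun k => (l k).mapDomain Sum.inl) (fun k => single (Sum.inr k) (1 : A)) =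
      Sum.elim (fun k => linearCombination A h (l k)) y := by
    ext i
    rcases i with k | k
    · simp [Finsupp.linearCombination_mapDomain]
    · simp
  rw [this]

theorem rename {P : ∀ (M : Type u) [AddCommGroup M] [Module A M], (W → M) → Prop} (hP : PPDef A P)
    (f : W → V) : PPDef A fun M _ _ (h : V → M) => P M (h ∘ f) := by
  refine (hP.subst fun k => single (f k) 1).congr fun M _ _ h => ?_
  simp only [Finsupp.linearCombination_single, one_smul]
  rfl

theorem linear (l : V →₀ A) : PPDef A fun M _ _ (h : V → M) => linearCombination A h l = 0 := by
  refine ⟨Empty, Unit, inferInstance, inferInstance, fun _ => l.mapDomain Sum.inl,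
    fun M _ _ h => ?_⟩
  simp [Finsupp.linearCombination_mapDomain]

theorem eq (a b : V) : PPDef A fun M _ _ (h : V → M) => h a = h b := by
  refine (linear (single a 1 - single b (1 : A))).congr fun M _ _ h => ?_
  simp [sub_eq_zero]

theorem true : PPDef A fun M _ _ (_ : V → M) => True :=
  (linear (0 : V →₀ A)).congr fun M _ _ h => by simp

theorem and (hP : PPDef A P) (hQ : PPDef A Q) : PPDef A fun M _ _ (h : V → M) => P M h ∧ Q M h := by
  obtain ⟨κ, ι, _, _, B, hB⟩ := hP
  obtain ⟨κ', ι', _, _, B', hB'⟩ := hQ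
  refine ⟨κ ⊕ κ', ι ⊕ ι', inferInstance, inferInstance,
    Sum.elim (fun j => (B j).mapDomain (Sum.map id Sum.inl))
      (fun j => (B' j).mapDomain (Sum.map id Sum.inr)), fun M _ _ h => ?_⟩
  beta_reduce
  rw [hB, hB']
  have h1 : ∀ y : κ ⊕ κ' → M, Sum.elim h y ∘ Sum.map id Sum.inl = Sum.elim h (y ∘ Sum.inl) :=
    fun y => by ext i; rcases i with i | i <;> rfl
  have h2 : ∀ y : κ ⊕ κ' → M, Sum.elim h y ∘ Sum.map id Sum.inr = Sum.elim h (y ∘ Sum.inr) :=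
    fun y => by ext i; rcases i with i | i <;> rfl
  constructor
  · rintro ⟨⟨y, hy⟩, ⟨y', hy'⟩⟩
    refine ⟨Sum.elim y y', ?_⟩
    rintro (j | j)
    · simpa only [Sum.elim_inl, Finsupp.linearCombination_mapDomain, h1, Sum.elim_comp_inl]
        using hy j
    · simpa only [Sum.elim_inr, Finsupp.linearCombination_mapDomain, h2, Sum.elim_comp_inr]
        using hy' j
  · rintro ⟨y, hy⟩
    refine ⟨⟨y ∘ Sum.inl, fun j => ?_⟩, ⟨y ∘ Sum.inr, fun j => ?_⟩⟩
    · have := hy (.inl j)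
      rwa [Sum.elim_inl, Finsupp.linearCombination_mapDomain, h1] at this
    · have := hy (.inr j)
      rwa [Sum.elim_inr, Finsupp.linearCombination_mapDomain, h2] at this

theorem forall_mem_finset {I : Type*} (s : Finset I)
    {P : I → ∀ (M : Type u) [AddCommGroup M] [Module A M], (V → M) → Prop}
    (hP : ∀ i ∈ s, PPDef A (P i)) : PPDef A fun M _ _ (h : V → M) => ∀ i ∈ s, P i M h := by
  classical
  induction s using Finset.induction_on with
  | empty => exact true.congr fun M _ _ h => by simp
  | insert i s _ ih =>
    refine ((hP i (Finset.mem_insert_self _ _)).and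
      (ih fun k hk => hP k (Finset.mem_insert_of_mem hk))).congr fun M _ _ h => ?_
    simp only [Finset.forall_mem_insert]

theorem forall_fintype {I : Type*} [Fintype I]
    {P : I → ∀ (M : Type u) [AddCommGroup M] [Module A M], (V → M) → Prop}
    (hP : ∀ i, PPDef A (P i)) : PPDef A fun M _ _ (h : V → M) => ∀ i, P i M h :=
  (forall_mem_finset Finset.univ fun i _ => hP i).congr fun M _ _ h => by simp

/-- pp-definable conditions are closed under quantification over finitely many elements. -/
theorem exists_fintype {κ : Type} [Fintype κ]
    {P : ∀ (M : Type u) [AddCommGroup M] [Module A M], (κ ⊕ V → M) → Prop} (hP : PPDef A P) :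
    PPDef A fun M _ _ (h : V → M) => ∃ z : κ → M, P M (Sum.elim z h) := by
  obtain ⟨κ', ι, _, _, B, hB⟩ := hP
  let f : (κ ⊕ V) ⊕ κ' → V ⊕ (κ ⊕ κ') :=
    Sum.elim (Sum.elim (Sum.inr ∘ Sum.inl) Sum.inl) (Sum.inr ∘ Sum.inr)
  refine ⟨κ ⊕ κ', ι, inferInstance, inferInstance, fun j => (B j).mapDomain f, fun M _ _ h => ?_⟩
  have hf : ∀ (y : κ ⊕ κ' → M), Sum.elim h y ∘ f =
      Sum.elim (Sum.elim (y ∘ Sum.inl) h) (y ∘ Sum.inr) := by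
    intro y
    ext i
    rcases i with (i | i) | i <;> rfl
  simp only [hB, Finsupp.linearCombination_mapDomain, hf]
  constructor
  · rintro ⟨z, y, hy⟩
    exact ⟨Sum.elim z y, hy⟩
  · rintro ⟨y, hy⟩
    exact ⟨y ∘ Sum.inl, y ∘ Sum.inr, hy⟩

theorem of_formula {ν : Type} [Fintype ν] (φ : PPFormula A ν) (v : ν → V) :
    PPDef A fun M _ _ (h : V → M) => h ∘ v ∈ φ.sol M := by
  suffices H : PPDef A fun M _ _ (h : ν → M) => h ∈ φ.sol M from H.rename v
  refine ⟨Fin φ.bound, Fin φ.eqs, inferInstance, inferInstance,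
    fun j => Finsupp.equivFunOnFinite.symm fun i => φ.mat i j, fun M _ _ h => ?_⟩
  beta_reduce
  rw [PPFormula.mem_sol]
  refine exists_congr fun y => forall_congr' fun j => ?_
  rw [Finsupp.linearCombination_apply, Finsupp.sum_fintype _ _ (by simp)]
  rfl

/-- pp-definable conditions on finite families are given by formulas. -/
theorem exists_formula {ν : Type} [Fintype ν]
    {P : ∀ (M : Type u) [AddCommGroup M] [Module A M], (ν → M) → Prop} (hP : PPDef A P) :
    ∃ φ : PPFormula A ν, ∀ (M : Type u) [AddCommGroup M] [Module A M] (h : ν → M),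
      h ∈ φ.sol M ↔ P M h := by
  obtain ⟨κ, ι, _, _, B, hB⟩ := hP
  refine ⟨PPFormula.ofCoeffs fun i j => B j i, fun M _ _ h => ?_⟩
  rw [hB, PPFormula.mem_sol_ofCoeffs]
  refine exists_congr fun y => forall_congr' fun j => ?_
  rw [Finsupp.linearCombination_apply, Finsupp.sum_fintype _ _ (by simp)]

/-- A pp-definable condition depends on finitely many variables only. -/
theorem exists_fin (hP : PPDef A P) : ∃ (n : ℕ) (v : Fin n → V), Function.Injective v ∧
    ∃ φ : PPFormula A (Fin n), ∀ (M : Type u) [AddCommGroup M] [Module A M] (h : V → M),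
      P M h ↔ h ∘ v ∈ φ.sol M := by
  classical
  obtain ⟨κ, ι, _, _, B, hB⟩ := hP
  let s : Finset V := (Finset.univ : Finset ι).biUnion fun j =>
    (B j).support.preimage Sum.inl Sum.inl_injective.injOn
  let e := s.equivFin
  let v : Fin s.card → V := fun i => (e.symm i).1
  have hv : Function.Injective v := Subtype.val_injective.comp e.symm.injective
  let g : Fin s.card ⊕ κ → V ⊕ κ := Sum.map v id
  have hg : Function.Injective g := hv.sumMap Function.injective_id
  have key : ∀ j, ((B j).comapDomain g hg.injOn).mapDomain g = B j := fun j => by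
    refine Finsupp.mapDomain_comapDomain g hg (B j) ?_
    rintro (x | k) hx
    · have hxs : x ∈ s := by
        simp only [s, Finset.mem_biUnion, Finset.mem_univ, true_and, Finset.mem_preimage]
        exact ⟨j, hx⟩
      exact ⟨.inl (e ⟨x, hxs⟩), by simp [g, v]⟩
    · exact ⟨.inr k, rfl⟩
  obtain ⟨φ, hφ⟩ := exists_formula (A := A) (ν := Fin s.card)
    (P := fun M _ _ h => ∃ y : κ → M, ∀ j, linearCombination A (Sum.elim h y)
      ((B j).comapDomain g hg.injOn) = 0)
    ⟨κ, ι, inferInstance, inferInstance, _, fun M _ _ h => Iff.rfl⟩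
  refine ⟨s.card, v, hv, φ, fun M _ _ h => ?_⟩
  rw [hB, hφ]
  refine exists_congr fun y => forall_congr' fun j => ?_
  have h1 : Sum.elim (h ∘ v) y = Sum.elim h y ∘ g := by
    ext i; rcases i with i | i <;> rfl
  rw [h1, ← Finsupp.linearCombination_mapDomain, key]

/-- pp-definable conditions are closed under quantification over families of elements, of any
size. -/
theorem exists_family {X : Type*}
    {P : ∀ (M : Type u) [AddCommGroup M] [Module A M], (X ⊕ V → M) → Prop} (hP : PPDef A P) :
    PPDef A fun M _ _ (h : V → M) => ∃ z : X → M, P M (Sum.elim z h) := by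
  classical
  obtain ⟨n, v, hv, φ, hφ⟩ := hP.exists_fin
  let f : Fin n → Fin n ⊕ V := fun i => Sum.elim (fun _ => Sum.inl i) Sum.inr (v i)
  refine (exists_fintype (of_formula φ f)).congr fun M _ _ h => ?_
  simp only [hφ]
  constructor
  · rintro ⟨z, hz⟩
    refine ⟨fun i => Sum.elim z h (v i), ?_⟩
    convert hz using 1
    ext i
    simp only [Function.comp_apply, f]
    rcases hi : v i with x | x
    · simp [hi]
    · rfl
  · rintro ⟨y, hy⟩
    refine ⟨fun x => if hx : ∃ i, v i = Sum.inl x then y hx.choose else 0, ?_⟩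
    convert hy using 1
    ext i
    simp only [Function.comp_apply, f]
    rcases hi : v i with x | x
    · have hx : ∃ i, v i = Sum.inl x := ⟨i, hi⟩
      simp only [Sum.elim_inl]
      rw [dif_pos hx]
      exact congrArg y (hv (hx.choose_spec.trans hi.symm))
    · rfl

end PPDef

/-- A formula together with an assignment of its free variables to elements of `V`. -/
structure PPCond (A : Type u) (V : Type w) where
  arity : ℕ
  formula : PPFormula A (Fin arity)
  var : Fin arity → V

/-- The family `h` satisfies the condition `c`. -/
def PPCond.Holds {V : Type w} (c : PPCond A V) {M : Type u} [AddCommGroup M] [Module A M]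
    (h : V → M) : Prop :=
  h ∘ c.var ∈ c.formula.sol M

theorem PPCond.ppDef {V : Type w} (c : PPCond A V) :
    PPDef A fun M _ _ (h : V → M) => c.Holds h :=
  PPDef.of_formula c.formula c.var

theorem PPCond.Holds.map {V : Type w} {c : PPCond A V} {M N : Type u} [AddCommGroup M] [Module A M]
    [AddCommGroup N] [Module A N] {h : V → M} (hc : c.Holds h) (f : M →ₗ[A] N) :
    c.Holds (f ∘ h) :=
  c.formula.map_mem_sol f hc

theorem PPDef.exists_cond {V : Type w}
    {P : ∀ (M : Type u) [AddCommGroup M] [Module A M], (V → M) → Prop} (hP : PPDef A P) :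
    ∃ c : PPCond A V, ∀ (M : Type u) [AddCommGroup M] [Module A M] (h : V → M),
      P M h ↔ c.Holds h := by
  obtain ⟨n, v, _, φ, hφ⟩ := hP.exists_fin
  exact ⟨⟨n, φ, v⟩, hφ⟩

theorem PPDef.map {P : ∀ (M : Type u) [AddCommGroup M] [Module A M], (V → M) → Prop}
    (hP : PPDef A P) {M N : Type u} [AddCommGroup M] [Module A M]
    [AddCommGroup N] [Module A N] {h : V → M} (hc : P M h) (f : M →ₗ[A] N) : P N (f ∘ h) := by
  obtain ⟨c, hP⟩ := hP.exists_cond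
  rw [hP] at hc ⊢
  exact hc.map f

/-- A function `h : X → M` is linear if it preserves all the pp-conditions on the elements
of `X`. -/
theorem exists_linearMap_of_conds {X M : Type u} [AddCommGroup X] [Module A X] [AddCommGroup M]
    [Module A M] (h : X → M) (H : ∀ c : PPCond A X, c.Holds (id : X → X) → c.Holds h) :
    ∃ f : X →ₗ[A] M, ⇑f = h := by
  have key : ∀ l : X →₀ A, linearCombination A id l = 0 → linearCombination A h l = 0 := by
    intro l hl
    obtain ⟨c, hc⟩ := (PPDef.linear l).exists_cond
    exact (hc M h).2 (H c ((hc X id).1 hl))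
  refine ⟨{ toFun := h, map_add' := fun x y => ?_, map_smul' := fun a x => ?_ }, rfl⟩
  · have := key (single (x + y) 1 - single x 1 - single y 1) (by simp)
    simpa [sub_sub, sub_eq_zero] using this
  · have := key (single (a • x) 1 - single x a) (by simp)
    simpa [sub_eq_zero] using this

/-- Pure embeddings reflect pp-conditions in any number of variables: these can be treated one at a
time. -/
theorem IsPureEmbedding.mem_sol {M N : ModuleCat.{u} A} {f : M ⟶ N} (hf : IsPureEmbedding f)
    {n : ℕ} (φ : PPFormula A (Fin n)) (x : Fin n → M) (hx : f.hom ∘ x ∈ φ.sol N) :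
    x ∈ φ.sol M := by
  induction n with
  | zero =>
    rw [Subsingleton.elim x 0]
    exact zero_mem _
  | succ n ih =>
    have hφ : PPDef A fun M _ _ (h : Fin (n + 1) → M) => h ∈ φ.sol M := PPDef.of_formula φ id
    -- the projection of `φ` to the first variable
    obtain ⟨φ₁, hφ₁⟩ := ((hφ.rename (V := Fin n ⊕ Fin 1)
      (Fin.cons (Sum.inr 0) Sum.inl)).exists_fintype).exists_formula
    -- the formula `φ(0, y)`
    obtain ⟨φ₀, hφ₀⟩ := (hφ.subst (V := Fin n) (Fin.cons 0 fun i => single i 1)).exists_formula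
    have e1 : ∀ (L : Type u) (z : Fin n → L) (a : Fin 1 → L),
        (Sum.elim z a ∘ (Fin.cons (Sum.inr 0) Sum.inl : Fin (n + 1) → Fin n ⊕ Fin 1)) =
          Fin.cons (a 0) z := by
      intro L z a
      ext i
      refine Fin.cases ?_ (fun i => ?_) i <;> simp
    have e0 : ∀ (L : Type u) [AddCommGroup L] [Module A L] (z : Fin n → L),
        (fun k => linearCombination A z
          ((Fin.cons 0 fun i => single i 1 : Fin (n + 1) → Fin n →₀ A) k)) =
          Fin.cons 0 z := by
      intro L _ _ z
      ext i
      refine Fin.cases ?_ (fun i => ?_) i <;> simp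
    simp only [e1] at hφ₁
    simp only [e0] at hφ₀
    have h1 : f.hom ∘ (fun _ : Fin 1 => x 0) ∈ φ₁.sol N := by
      rw [hφ₁]
      refine ⟨f.hom ∘ Fin.tail x, ?_⟩
      convert hx using 1
      ext i
      refine Fin.cases ?_ (fun i => ?_) i <;> simp [Fin.tail]
    rw [hf.2, hφ₁] at h1
    obtain ⟨b, hb⟩ := h1
    have h2 : x - Fin.cons (x 0) b = Fin.cons 0 (Fin.tail x - b) := by
      ext i
      refine Fin.cases ?_ (fun i => ?_) i <;> simp [Fin.tail]
    have h3 : f.hom ∘ (Fin.tail x - b) ∈ φ₀.sol N := by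
      rw [hφ₀]
      convert sub_mem hx (φ.map_mem_sol f.hom hb) using 1
      ext i
      refine Fin.cases ?_ (fun i => ?_) i <;> simp [Fin.tail]
    have h4 := ih φ₀ _ h3
    rw [hφ₀, ← h2] at h4
    simpa using add_mem h4 hb

end PPDef

/-! ### pp-conditions in products and direct limits -/

section

variable {A : Type u} [Ring A] {V : Type w}

open Finsupp (linearCombination single)

theorem PPDef.pi_iff {P : ∀ (M : Type u) [AddCommGroup M] [Module A M], (V → M) → Prop}
    (hP : PPDef A P) {ι : Type u} (M : ι → Type u) [∀ i, AddCommGroup (M i)]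
    [∀ i, Module A (M i)] (h : V → ∀ i, M i) :
    P (∀ i, M i) h ↔ ∀ i, P (M i) fun x => h x i := by
  constructor
  · intro hh i
    exact hP.map hh (LinearMap.proj i)
  · intro hh
    obtain ⟨κ, ι', _, _, B, hB⟩ := hP
    simp only [hB] at hh ⊢
    choose y hy using hh
    refine ⟨fun k i => y i k, fun j => funext fun i => ?_⟩
    have h1 := Finsupp.apply_linearCombination A (LinearMap.proj (φ := M) i)
      (Sum.elim h fun k i => y i k) (B j)
    rw [LinearMap.proj_apply] at h1
    rw [h1, Pi.zero_apply, ← hy i j]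
    congr 2
    ext x
    rcases x with x | x <;> rfl

section DirectLimit

variable {J : Type u} [Preorder J] {F : J ⥤ ModuleCat.{u} A} {c : Cocone F}

theorem directLimit_ι_map {j k : J} (hjk : j ≤ k) (x : F.obj j) :
    (c.ι.app k).hom ((F.map (homOfLE hjk)).hom x) = (c.ι.app j).hom x := by
  rw [← c.w (homOfLE hjk)]
  rfl

theorem directLimit_map_map {j k l : J} (hjk : j ≤ k) (hkl : k ≤ l) (x : F.obj j) :
    (F.map (homOfLE hkl)).hom ((F.map (homOfLE hjk)).hom x) =
      (F.map (homOfLE (hjk.trans hkl))).hom x := by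
  rw [← homOfLE_comp hjk hkl, F.map_comp]
  rfl

variable [IsDirectedOrder J] [Nonempty J]

theorem directLimit_exists_rep (hc : IsColimit c) (x : c.pt) :
    ∃ j, ∃ y : F.obj j, (c.ι.app j).hom y = x :=
  Concrete.isColimit_exists_rep F hc x

theorem directLimit_exists_eq_zero (hc : IsColimit c) {j : J} (x : F.obj j)
    (hx : (c.ι.app j).hom x = 0) : ∃ k, ∃ hjk : j ≤ k, (F.map (homOfLE hjk)).hom x = 0 := by
  obtain ⟨k, f, g, h⟩ := Concrete.isColimit_exists_of_rep_eq F hc x (0 : F.obj j)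
    (by simpa using hx)
  refine ⟨k, leOfHom f, ?_⟩
  rw [Subsingleton.elim (homOfLE (leOfHom f)) f]
  exact h.trans (map_zero (F.map g).hom)

/-- Finitely many elements of a direct limit have representatives at a common stage. -/
theorem directLimit_exists_family (hc : IsColimit c) {κ : Type*} [Finite κ] (x : κ → c.pt)
    (j₀ : J) : ∃ j, j₀ ≤ j ∧ ∃ y : κ → F.obj j, (c.ι.app j).hom ∘ y = x := by
  choose j y hy using fun k => directLimit_exists_rep hc (x k)
  obtain ⟨l, hl⟩ := Finite.exists_le (fun k : Option κ => k.elim j₀ j)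
  refine ⟨l, hl none, fun k => (F.map (homOfLE (hl (some k)))).hom (y k), ?_⟩
  ext k
  exact (directLimit_ι_map (hl (some k)) (y k)).trans (hy k)

/-- Finitely many elements at one stage which vanish in the direct limit vanish at a common later
stage. -/
theorem directLimit_exists_zero_family (hc : IsColimit c) {κ : Type*} [Finite κ] {j : J}
    (x : κ → F.obj j) (hx : ∀ k, (c.ι.app j).hom (x k) = 0) :
    ∃ k, ∃ hjk : j ≤ k, ∀ i, (F.map (homOfLE hjk)).hom (x i) = 0 := by
  choose l hl h0 using fun k => directLimit_exists_eq_zero hc (x k) (hx k)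
  obtain ⟨m, hm⟩ := Finite.exists_le (fun k : Option κ => k.elim j l)
  refine ⟨m, hm none, fun i => ?_⟩
  rw [← directLimit_map_map (hl i) (hm (some i)), h0, map_zero]

/-- A pp-condition holds in a direct limit if and only if it holds at some stage. -/
theorem PPDef.directLimit_iff
    {P : ∀ (M : Type u) [AddCommGroup M] [Module A M], (V → M) → Prop}
    (hP : PPDef A P) (hc : IsColimit c) {j : J} (h : V → F.obj j) :
    P c.pt ((c.ι.app j).hom ∘ h) ↔
      ∃ k, ∃ hjk : j ≤ k, P (F.obj k) ((F.map (homOfLE hjk)).hom ∘ h) := by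
  constructor
  · obtain ⟨κ, ι, _, _, B, hB⟩ := hP
    intro hh
    rw [hB] at hh
    obtain ⟨y, hy⟩ := hh
    obtain ⟨k, hjk, z, rfl⟩ := directLimit_exists_family hc y j
    have key : ∀ l, Sum.elim ((c.ι.app j).hom ∘ h) ((c.ι.app k).hom ∘ z) l =
        (c.ι.app k).hom (Sum.elim ((F.map (homOfLE hjk)).hom ∘ h) z l) := by
      rintro (l | l)
      · exact (directLimit_ι_map hjk (h l)).symm
      · rfl
    obtain ⟨m, hkm, hm⟩ := directLimit_exists_zero_family hc
      (fun i => linearCombination A (Sum.elim ((F.map (homOfLE hjk)).hom ∘ h) z) (B i)) (by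
        intro i
        rw [Finsupp.apply_linearCombination, ← hy i]
        congr 2
        ext l
        exact (key l).symm)
    refine ⟨m, hjk.trans hkm, (hB _ _).2 ⟨(F.map (homOfLE hkm)).hom ∘ z, fun i => ?_⟩⟩
    rw [← hm i, Finsupp.apply_linearCombination]
    congr 2
    ext l
    rcases l with l | l
    · exact (directLimit_map_map hjk hkm (h l)).symm
    · rfl
  · rintro ⟨k, hjk, hk⟩
    have e : (((c.ι.app k).hom ∘ (F.map (homOfLE hjk)).hom ∘ h : V → c.pt)) =
        (c.ι.app j).hom ∘ h := funext fun l => directLimit_ι_map hjk (h l)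
    exact Eq.mp (congrArg (P c.pt) e) (hP.map hk (c.ι.app k).hom)

end DirectLimit

/-! ### Realizing sets of pp-conditions in definable subcategories -/

/-- The directed system with direct limit the reduced product of the modules `N s` with respect to
the filter generated by the sets `{s | t ⊆ s}`. -/
def reducedProductSystem {κ : Type u} (N : Finset κ → ModuleCat.{u} A) :
    Finset κ ⥤ ModuleCat.{u} A where
  obj t := ModuleCat.of A (∀ s : {s : Finset κ // t ≤ s}, N s.1)
  map {t t'} f := ModuleCat.ofHom
    (LinearMap.pi fun s : {s : Finset κ // t' ≤ s} =>
      (LinearMap.proj (⟨s.1, (leOfHom f).trans s.2⟩ : {s : Finset κ // t ≤ s}) :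
        (∀ s : {s : Finset κ // t ≤ s}, N s.1) →ₗ[A] N s.1))

/-- Compactness: in a definable subcategory, positive conditions `P k` and negated
conditions `Q i` are realized simultaneously as soon as any finitely many of the `P k` are
realized together with any single negated `Q i`. Products take care of several negated conditions,
reduced products of infinitely many positive ones. -/
theorem IsDefinable.exists_realization {C : ObjectProperty (ModuleCat.{u} A)} (hC : IsDefinable C)
    {κ ι : Type u} {P : κ → ∀ (M : Type u) [AddCommGroup M] [Module A M], (V → M) → Prop}
    {Q : ι → ∀ (M : Type u) [AddCommGroup M] [Module A M], (V → M) → Prop}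
    (hP : ∀ k, PPDef A (P k)) (hQ : ∀ i, PPDef A (Q i))
    (H : ∀ (s : Finset κ) (i : ι), ∃ (M : ModuleCat.{u} A) (_ : C M) (h : V → M),
      (∀ k ∈ s, P k M h) ∧ ¬ Q i M h) :
    ∃ (M : ModuleCat.{u} A) (_ : C M) (h : V → M), (∀ k, P k M h) ∧ ∀ i, ¬ Q i M h := by
  classical
  choose M hM h hPM hQM using H
  let N : Finset κ → ModuleCat.{u} A := fun s => ModuleCat.of A (∀ i, M s i)
  have hN : ∀ s, C (N s) := fun s => hC.product _ _ fun i => hM s i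
  let F := reducedProductSystem N
  let c := colimit.cocone F
  have hc : IsColimit c := colimit.isColimit F
  let g : V → F.obj ∅ := fun x s i => h s.1 i x
  refine ⟨c.pt, hC.directLimit _ F c hc fun t => hC.product _ _ fun s => hN s.1,
    (c.ι.app ∅).hom ∘ g, fun k => ?_, fun i hi => ?_⟩
  · rw [(hP k).directLimit_iff hc]
    refine ⟨{k}, Finset.empty_subset _, ?_⟩
    refine ((hP k).pi_iff (fun s : {s : Finset κ // {k} ≤ s} => N s.1) _).2 fun s => ?_
    refine ((hP k).pi_iff (fun i => M s.1 i) _).2 fun i => ?_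
    exact hPM s.1 i k (s.2 (Finset.mem_singleton_self k))
  · rw [(hQ i).directLimit_iff hc] at hi
    obtain ⟨t, ht, hi⟩ := hi
    have h1 := ((hQ i).pi_iff (fun s : {s : Finset κ // t ≤ s} => N s.1) _).1 hi ⟨t, le_rfl⟩
    exact hQM t i (((hQ i).pi_iff (fun i => M t i) _).1 h1 i)

/-- A module which satisfies all implications between pp-formulas that are valid in a definable
subcategory belongs to it: it is a pure submodule of a realization of its positive and negative
pp-conditions. -/
theorem IsDefinable.mem_of_le {C : ObjectProperty (ModuleCat.{u} A)} (hC : IsDefinable C)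
    (N : ModuleCat.{u} A)
    (H : ∀ (n : ℕ) (σ τ : PPFormula A (Fin n)),
      (∀ M : ModuleCat.{u} A, C M → σ.sol M ≤ τ.sol M) → σ.sol N ≤ τ.sol N) : C N := by
  obtain ⟨M, hM, h, hpos, hneg⟩ := hC.exists_realization (V := N)
    (κ := {c : PPCond A N // c.Holds (id : N → N)})
    (ι := {c : PPCond A N // ¬ c.Holds (id : N → N)})
    (P := fun c M _ _ h => c.1.Holds h) (Q := fun c M _ _ h => c.1.Holds h)
    (fun c => c.1.ppDef) (fun c => c.1.ppDef) (by
      rintro s ⟨q, hq⟩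
      by_contra! hcon
      refine hq ?_
      have hs : PPDef A fun M _ _ (h : N → M) => ∀ k ∈ s, k.1.Holds h :=
        PPDef.forall_mem_finset s fun k _ => k.1.ppDef
      -- the pp-type of `q.var` implied by the conditions in `s`
      have hσ := ((hs.rename (V := N ⊕ Fin q.arity) Sum.inl).and
        (PPDef.forall_fintype fun k : Fin q.arity =>
          PPDef.eq (Sum.inl (q.var k)) (Sum.inr k))).exists_family
      obtain ⟨σ, hσ⟩ := hσ.exists_formula
      refine H _ σ q.formula (fun M hM x hx => ?_) ((hσ N _).2 ⟨id, fun k _ => k.2, fun k => rfl⟩)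
      obtain ⟨h, hh, hx⟩ := (hσ M x).1 hx
      have := hcon M hM h hh
      rwa [PPCond.Holds, show h ∘ q.var = x from funext hx] at this)
  obtain ⟨f, rfl⟩ := exists_linearMap_of_conds h fun c hc => hpos ⟨c, hc⟩
  refine hC.pureSubmodule N M (ModuleCat.ofHom f) ⟨?_, fun φ x => ⟨fun hx => ?_, fun hx => ?_⟩⟩ hM
  · intro x y hxy
    by_contra hne
    obtain ⟨c, hc⟩ := (PPDef.eq (A := A) x y).exists_cond
    exact hneg ⟨c, fun hcc => hne ((hc N id).2 hcc)⟩ ((hc M f).1 hxy)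
  · by_contra hne
    exact hneg ⟨⟨1, φ, x⟩, hne⟩ hx
  · exact φ.map_mem_sol f hx

/-- The modules in which one pp-formula implies another form a definable subcategory. -/
theorem isDefinable_of_formulas {n : ℕ} (σ τ : PPFormula A (Fin n)) :
    IsDefinable fun M : ModuleCat.{u} A => σ.sol M ≤ τ.sol M where
  product ι M hM x hx := by
    have hσ : PPDef A fun M _ _ (h : Fin n → M) => h ∈ σ.sol M := PPDef.of_formula σ id
    have hτ : PPDef A fun M _ _ (h : Fin n → M) => h ∈ τ.sol M := PPDef.of_formula τ id
    exact (hτ.pi_iff (fun i => M i) x).2 fun i => hM i ((hσ.pi_iff (fun i => M i) x).1 hx i)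
  directLimit J _ _ _ F c hc hF x hx := by
    have hσ : PPDef A fun M _ _ (h : Fin n → M) => h ∈ σ.sol M := PPDef.of_formula σ id
    obtain ⟨j, _, y, rfl⟩ := directLimit_exists_family hc x (Classical.arbitrary J)
    obtain ⟨k, hjk, hk⟩ := (hσ.directLimit_iff hc y).1 hx
    have e : (((c.ι.app k).hom ∘ (F.map (homOfLE hjk)).hom ∘ y : Fin n → c.pt)) =
        (c.ι.app j).hom ∘ y := funext fun l => directLimit_ι_map hjk (y l)
    exact Eq.mp (congrArg (· ∈ τ.sol c.pt) e) (τ.map_mem_sol (c.ι.app k).hom (hF k hk))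
  pureSubmodule M N f hf hN x hx :=
    hf.mem_sol τ x (hN (σ.map_mem_sol f.hom hx))

/-- Implications between pp-formulas pass to the definable closure. -/
theorem sol_le_of_definableClosure {X : ObjectProperty (ModuleCat.{u} A)} {n : ℕ}
    {σ τ : PPFormula A (Fin n)} (h : ∀ M, X M → σ.sol M ≤ τ.sol M) (M : ModuleCat.{u} A)
    (hM : definableClosure X M) : σ.sol M ≤ τ.sol M :=
  hM _ (isDefinable_of_formulas σ τ) h

end

/-! ### Characters of abelian groups -/

section Characters

variable {G : Type u} {H : Type v} [AddCommGroup G] [AddCommGroup H]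

/-- Characters with values in the circle group extend, because the circle is divisible. -/
theorem exists_character_comp_eq (Φ : G →+ H) (f : G →+ UnitAddCircle)
    (h : ∀ x, Φ x = 0 → f x = 0) : ∃ g : H →+ UnitAddCircle, ∀ x, g (Φ x) = f x := by
  have hle : Φ.ker ≤ f.ker := fun x hx => h x hx
  obtain ⟨g, hg⟩ := (Module.Baer.of_divisible UnitAddCircle).extension_property_addMonoidHom
    (QuotientAddGroup.kerLift Φ) (QuotientAddGroup.kerLift_injective Φ)
    (QuotientAddGroup.lift Φ.ker f hle)
  exact ⟨g, fun x => DFunLike.congr_fun hg (QuotientAddGroup.mk x)⟩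

theorem exists_character_ne_zero {x : G} (hx : x ≠ 0) : ∃ χ : G →+ UnitAddCircle, χ x ≠ 0 := by
  obtain ⟨c, hc⟩ := CharacterModule.exists_character_apply_ne_zero_of_ne_zero hx
  -- the embedding of `ℚ / ℤ` into `ℝ / ℤ`
  let ι : AddCircle (1 : ℚ) →+ UnitAddCircle :=
    QuotientAddGroup.map _ _ (Rat.castHom ℝ).toAddMonoidHom (by
      rintro _ ⟨n, rfl⟩
      exact ⟨n, by simp⟩)
  refine ⟨ι.comp c, fun h => hc ?_⟩
  have h' : ι (c x) = 0 := h
  obtain ⟨q, hq⟩ := QuotientAddGroup.mk_surjective (c x)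
  rw [← hq] at h' ⊢
  have h2 : ((q : ℝ) : UnitAddCircle) = 0 := h'
  obtain ⟨n, hn⟩ := (AddCircle.coe_eq_zero_iff (1 : ℝ)).1 h2
  refine (AddCircle.coe_eq_zero_iff (1 : ℚ)).2 ⟨n, ?_⟩
  have : (n : ℝ) = q := by simpa using hn
  simpa using (by exact_mod_cast this : (n : ℚ) = q)

/-- Characters separate points from subgroups. -/
theorem exists_character_of_notMem (K : AddSubgroup G) {x : G} (hx : x ∉ K) :
    ∃ χ : G →+ UnitAddCircle, (∀ y ∈ K, χ y = 0) ∧ χ x ≠ 0 := by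
  have hne : (QuotientAddGroup.mk x : G ⧸ K) ≠ 0 := by
    rwa [Ne, QuotientAddGroup.eq_zero_iff]
  obtain ⟨χ, hχ⟩ := exists_character_ne_zero hne
  refine ⟨χ.comp (QuotientAddGroup.mk' K), fun y hy => ?_, hχ⟩
  rw [AddMonoidHom.comp_apply, QuotientAddGroup.mk'_apply, (QuotientAddGroup.eq_zero_iff y).2 hy,
    map_zero]

end Characters

/-! ### The double character module -/

section Bidual

variable {A : Type u} [Ring A]

/-- The characters of the character group of `M`, as a closed subgroup of a power of the circle. -/
def bidualSubgroup (M : Type u) [AddCommGroup M] :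
    AddSubgroup ((M →+ UnitAddCircle) → UnitAddCircle) where
  carrier := {ξ | ∀ χ χ', ξ (χ + χ') = ξ χ + ξ χ'}
  zero_mem' := fun _ _ => by simp
  add_mem' := fun {ξ ξ'} h h' χ χ' => by
    rw [Pi.add_apply, Pi.add_apply, Pi.add_apply, h, h']
    abel
  neg_mem' := fun {ξ} h χ χ' => by
    rw [Pi.neg_apply, Pi.neg_apply, Pi.neg_apply, h]
    abel

/-- The double character module of `M`. -/
abbrev Bidual (M : Type u) [AddCommGroup M] : Type u := bidualSubgroup M

namespace Bidual

variable {M : Type u} [AddCommGroup M] [Module A M]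

theorem ext {ξ ξ' : Bidual M} (h : ∀ χ, ξ.1 χ = ξ'.1 χ) : ξ = ξ' :=
  Subtype.ext (funext h)

/-- An element of the bidual as a homomorphism. -/
def toHom (ξ : Bidual M) : (M →+ UnitAddCircle) →+ UnitAddCircle :=
  AddMonoidHom.mk' ξ.1 ξ.2

@[simp] theorem toHom_apply (ξ : Bidual M) (χ : M →+ UnitAddCircle) : ξ.toHom χ = ξ.1 χ := rfl

/-- A homomorphism as an element of the bidual. -/
def ofHom (g : (M →+ UnitAddCircle) →+ UnitAddCircle) : Bidual M := ⟨g, g.map_add⟩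

@[simp] theorem ofHom_val (g : (M →+ UnitAddCircle) →+ UnitAddCircle) (χ : M →+ UnitAddCircle) :
    (ofHom g).1 χ = g χ := rfl

/-- The ring acts on the double character module through its action on `M`. -/
instance : Module A (Bidual M) where
  smul a ξ := ⟨fun χ => ξ.1 (χ.comp (DistribSMul.toAddMonoidHom M a)), fun χ χ' =>
    (congrArg ξ.1 (AddMonoidHom.add_comp χ χ' _)).trans (ξ.2 _ _)⟩
  one_smul ξ := ext fun χ => congrArg ξ.1 (by ext; simp)
  mul_smul a b ξ := ext fun χ => congrArg ξ.1 (by ext; simp [mul_smul])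
  smul_zero a := rfl
  smul_add a ξ ξ' := rfl
  add_smul a b ξ := ext fun χ => by
    refine Eq.trans (congrArg ξ.1 ?_) (ξ.2 _ _)
    ext; simp [add_smul]
  zero_smul ξ := ext fun χ => by
    refine Eq.trans (congrArg ξ.1 ?_) (map_zero ξ.toHom)
    ext; simp

theorem smul_val (a : A) (ξ : Bidual M) (χ : M →+ UnitAddCircle) :
    (a • ξ).1 χ = ξ.1 (χ.comp (DistribSMul.toAddMonoidHom M a)) := rfl

theorem toHom_smul (a : A) (ξ : Bidual M) (χ : M →+ UnitAddCircle) :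
    (a • ξ).toHom χ = ξ.toHom (χ.comp (DistribSMul.toAddMonoidHom M a)) := rfl

theorem isClosed_bidualSubgroup :
    IsClosed (bidualSubgroup M : Set ((M →+ UnitAddCircle) → UnitAddCircle)) := by
  have : (bidualSubgroup M : Set ((M →+ UnitAddCircle) → UnitAddCircle)) =
      ⋂ χ, ⋂ χ', {ξ | ξ (χ + χ') = ξ χ + ξ χ'} := by
    ext ξ
    simp [bidualSubgroup]
  rw [this]
  exact isClosed_iInter fun χ => isClosed_iInter fun χ' =>
    isClosed_eq (continuous_apply (χ + χ')) (by fun_prop)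

instance : CompactSpace (Bidual M) :=
  isCompact_iff_compactSpace.1 isClosed_bidualSubgroup.isCompact

instance : ContinuousConstSMul A (Bidual M) where
  continuous_const_smul a :=
    Continuous.subtype_mk (f := fun (ξ : Bidual M) (χ : M →+ UnitAddCircle) =>
      ξ.1 (χ.comp (DistribSMul.toAddMonoidHom M a)))
      (continuous_pi fun _ => (continuous_apply _).comp continuous_subtype_val) _

variable (A M) in
/-- The canonical map of a module to its double character module. -/
def eval : M →ₗ[A] Bidual M where
  toFun x := ⟨fun χ => χ x, fun _ _ => rfl⟩
  map_add' x y := ext fun χ => map_add χ x y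
  map_smul' _ _ := rfl

/-- The solution set of a pp-formula in the double character module consists of the families which
vanish on all the characters that vanish on the solution set in `M`. Both inclusions are
extensions of characters. -/
theorem mem_sol_iff {ν : Type} [Fintype ν] [DecidableEq ν] (φ : PPFormula A ν) (ξ : ν → Bidual M) :
    ξ ∈ φ.sol (Bidual M) ↔ ∀ χ : (ν → M) →+ UnitAddCircle, (∀ x ∈ φ.sol M, χ x = 0) →
      ∑ i, (ξ i).1 (χ.comp (AddMonoidHom.single (fun _ => M) i)) = 0 := by
  classical
  constructor
  · rintro ⟨y, hy⟩ χ hχ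
    -- the linear map whose kernel projects onto the solution set
    let B : (ν ⊕ Fin φ.bound → M) →+ (Fin φ.eqs → M) :=
      { toFun := fun w j => ∑ i, φ.mat i j • w i
        map_zero' := by ext; simp
        map_add' := fun w w' => by ext; simp [Finset.sum_add_distrib] }
    let res : (ν ⊕ Fin φ.bound → M) →+ (ν → M) :=
      { toFun := fun w => w ∘ Sum.inl
        map_zero' := rfl
        map_add' := fun _ _ => rfl }
    obtain ⟨μ, hμ⟩ := exists_character_comp_eq B (χ.comp res) (by
      intro w hw
      refine hχ _ ⟨w ∘ Sum.inr, fun j => ?_⟩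
      have : Sum.elim (res w) (w ∘ Sum.inr) = w := Sum.elim_comp_inl_inr w
      rw [this]
      exact congrFun hw j)
    have h1 : ∀ i, (Sum.elim ξ y i).1 ((χ.comp res).comp (AddMonoidHom.single (fun _ => M) i)) =
        ∑ j, (φ.mat i j • Sum.elim ξ y i).1 (μ.comp (AddMonoidHom.single (fun _ => M) j)) := by
      intro i
      simp only [← toHom_apply, toHom_smul]
      rw [← map_sum]
      · congr 1
        ext m
        have h2 : B (Pi.single i m) = ∑ j, Pi.single j (φ.mat i j • m) := by
          ext j
          rw [Finset.sum_apply, Finset.sum_pi_single]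
          change ∑ k, φ.mat k j • (Pi.single i m : ν ⊕ Fin φ.bound → M) k = _
          rw [Finset.sum_eq_single i (fun k _ hk => by rw [Pi.single_eq_of_ne hk, smul_zero])
            (by simp), Pi.single_eq_same, if_pos (Finset.mem_univ j)]
        have h3 := hμ (Pi.single i m)
        rw [h2, map_sum] at h3
        rw [AddMonoidHom.comp_apply, AddMonoidHom.single_apply, ← h3]
        simp
    have h3 : ∑ i, (Sum.elim ξ y i).1 ((χ.comp res).comp (AddMonoidHom.single (fun _ => M) i)) =
        0 := by
      simp only [h1]
      rw [Finset.sum_comm]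
      refine Finset.sum_eq_zero fun j _ => ?_
      have h4 := congrArg (fun ζ : Bidual M => ζ.1 (μ.comp (AddMonoidHom.single (fun _ => M) j)))
        (hy j)
      simpa using h4
    rw [Fintype.sum_sum_type] at h3
    have h5 : ∀ k : Fin φ.bound, (χ.comp res).comp
        (AddMonoidHom.single (fun _ : ν ⊕ Fin φ.bound => M) (Sum.inr k)) = 0 := by
      intro k
      ext m
      have : res (Pi.single (Sum.inr k) m) = 0 := by ext i; simp [res]
      simp [this]
    have h6 : ∀ k : ν, (χ.comp res).comp
        (AddMonoidHom.single (fun _ : ν ⊕ Fin φ.bound => M) (Sum.inl k)) =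
          χ.comp (AddMonoidHom.single (fun _ => M) k) := by
      intro k
      ext m
      have : res (Pi.single (Sum.inl k) m) = Pi.single k m := by
        ext i; simp [res, Pi.single_apply]
      simp [this]
    simp only [h5, h6, Sum.elim_inl, Sum.elim_inr] at h3
    have h7 : ∀ k, (y k).1 0 = 0 := fun k => map_zero (y k).toHom
    simpa [h7] using h3
  · intro hξ
    let act : A → (M →+ UnitAddCircle) →+ (M →+ UnitAddCircle) := fun a =>
      { toFun := fun χ => χ.comp (DistribSMul.toAddMonoidHom M a)
        map_zero' := rfl
        map_add' := fun _ _ => rfl }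
    let Φ : (ν → (M →+ UnitAddCircle)) × (Fin φ.eqs → (M →+ UnitAddCircle)) →+
        (ν ⊕ Fin φ.bound → (M →+ UnitAddCircle)) :=
      { toFun := fun p i => Sum.elim p.1 0 i + ∑ j, act (φ.mat i j) (p.2 j)
        map_zero' := by ext i : 1; rcases i with i | i <;> simp
        map_add' := fun p q => by
          ext i : 1
          rcases i with i | i <;> simp [Finset.sum_add_distrib, add_add_add_comm] }
    let f : (ν → (M →+ UnitAddCircle)) × (Fin φ.eqs → (M →+ UnitAddCircle)) →+ UnitAddCircle :=
      { toFun := fun p => ∑ i, (ξ i).1 (p.1 i)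
        map_zero' := Finset.sum_eq_zero fun i _ => map_zero (ξ i).toHom
        map_add' := fun p q => by
          rw [← Finset.sum_add_distrib]
          exact Finset.sum_congr rfl fun i _ => (ξ i).2 _ _ }
    obtain ⟨g, hg⟩ := exists_character_comp_eq Φ f (by
      rintro ⟨α, μ⟩ hp
      let χ : (ν → M) →+ UnitAddCircle := ∑ i, (α i).comp (Pi.evalAddMonoidHom _ i)
      have hχ : ∀ x, χ x = ∑ i, α i (x i) := fun x => by simp [χ]
      have h1 := hξ χ (by
        rintro x ⟨y, hy⟩
        have e : ∑ i, (Φ (α, μ)) i (Sum.elim x y i) = χ x := by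
          have e1 : ∀ i, (Φ (α, μ)) i (Sum.elim x y i) =
              Sum.elim (α) 0 i (Sum.elim x y i) + ∑ j, μ j (φ.mat i j • Sum.elim x y i) := by
            intro i
            simp [Φ, act]
          simp only [e1]
          rw [Finset.sum_add_distrib, Finset.sum_comm]
          simp only [← map_sum, hy]
          simp [hχ]
        rw [← e, hp]
        simp)
      refine Eq.trans (Finset.sum_congr rfl fun i _ => ?_) h1
      refine congrArg (ξ i).1 ?_
      ext m
      simp only [AddMonoidHom.comp_apply, hχ, AddMonoidHom.single_apply]
      rw [Finset.sum_eq_single i]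
      · simp
      · intro k _ hk
        simp [Pi.single_eq_of_ne hk]
      · simp)
    have hinl : ∀ (i : ν) (α : (M →+ UnitAddCircle)),
        Φ (Pi.single i α, 0) = Pi.single (Sum.inl i) α := by
      intro i α
      ext k : 1
      rcases k with k | k
      · by_cases hk : k = i
        · subst hk; simp [Φ]
        · simp [Φ, Pi.single_eq_of_ne hk,
            Pi.single_eq_of_ne (fun h => hk (Sum.inl_injective h) : Sum.inl k ≠ Sum.inl i)]
      · simp [Φ]
    have hμ : ∀ (j : Fin φ.eqs) (μ : (M →+ UnitAddCircle)),
        Φ (0, Pi.single j μ) = ∑ i, Pi.single i (act (φ.mat i j) μ) := by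
      intro j μ
      ext k : 1
      rw [Finset.sum_apply, Finset.sum_eq_single k (fun i _ hi => Pi.single_eq_of_ne hi.symm _)
        (by simp), Pi.single_eq_same]
      have : ∑ l, act (φ.mat k l) ((Pi.single j μ : Fin φ.eqs → (M →+ UnitAddCircle)) l) =
          act (φ.mat k j) μ := by
        rw [Finset.sum_eq_single j]
        · simp
        · intro l _ hl
          simp [Pi.single_eq_of_ne hl]
        · simp
      rcases k with k | k <;> simpa [Φ] using this
    let z : ν ⊕ Fin φ.bound → Bidual M := fun i =>
      ofHom (g.comp (AddMonoidHom.single (fun _ => M →+ UnitAddCircle) i))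
    have hz : Sum.elim ξ (z ∘ Sum.inr) = z := by
      ext i : 1
      rcases i with i | i
      · refine ext fun α => ?_
        have : g (Pi.single (Sum.inl i) α) = f (Pi.single i α, 0) := by rw [← hinl, hg]
        simp only [Sum.elim_inl, z, ofHom_val, AddMonoidHom.comp_apply, AddMonoidHom.single_apply]
        rw [this]
        change _ = ∑ k, (ξ k).1 ((Pi.single i α : ν → (M →+ UnitAddCircle)) k)
        rw [Finset.sum_eq_single i]
        · simp
        · intro k _ hk
          rw [Pi.single_eq_of_ne hk]
          exact map_zero (ξ k).toHom
        · simp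
      · rfl
    refine ⟨z ∘ Sum.inr, fun j => ext fun μ => ?_⟩
    rw [hz]
    have h0 : f (0, Pi.single j μ) = 0 := Finset.sum_eq_zero fun i _ => map_zero (ξ i).toHom
    rw [← hg, hμ, map_sum] at h0
    simpa [z, smul_val, act] using h0

theorem sol_mono {ν : Type} [Fintype ν] {σ τ : PPFormula A ν} (h : σ.sol M ≤ τ.sol M) :
    σ.sol (Bidual M) ≤ τ.sol (Bidual M) := by
  classical
  intro ξ hξ
  rw [mem_sol_iff] at hξ ⊢
  exact fun χ hχ => hξ χ fun x hx => hχ x (h hx)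

theorem eval_mem_sol_iff {ν : Type} [Fintype ν] (φ : PPFormula A ν) (x : ν → M) :
    eval A M ∘ x ∈ φ.sol (Bidual M) ↔ x ∈ φ.sol M := by
  classical
  refine ⟨fun h => ?_, fun h => φ.map_mem_sol _ h⟩
  by_contra hx
  obtain ⟨χ, hχ, hne⟩ := exists_character_of_notMem (φ.sol M) hx
  rw [mem_sol_iff] at h
  refine hne ?_
  rw [← h χ hχ]
  conv_lhs => rw [← Finset.univ_sum_single x, map_sum]
  rfl

theorem mem_of_isDefinable {C : ObjectProperty (ModuleCat.{u} A)} (hC : IsDefinable C)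
    {M : ModuleCat.{u} A} (hM : C M) : C (ModuleCat.of A (Bidual M)) :=
  hC.mem_of_le _ fun _ _ _ h => sol_mono (h M hM)

end Bidual

end Bidual

/-! ### Algebraically compact modules -/

section AlgCompact

variable {A : Type u} [Ring A]

/-- A module `N` is algebraically compact if every set of pp-conditions with parameters in `N` that
is finitely satisfiable in `N` is satisfiable in `N`. The conditions concern the unknowns indexed
by `V` and the elements of `N`. -/
def AlgCompact (A : Type u) [Ring A] (N : Type u) [AddCommGroup N] [Module A N] : Prop :=
  ∀ (V I : Type u) (P : I → ∀ (M : Type u) [AddCommGroup M] [Module A M], (V ⊕ N → M) → Prop),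
    (∀ i, PPDef A (P i)) →
    (∀ s : Finset I, ∃ h : V → N, ∀ i ∈ s, P i N (Sum.elim h id)) →
    ∃ h : V → N, ∀ i, P i N (Sum.elim h id)

section Topology

variable {N : Type u} [AddCommGroup N] [Module A N] [TopologicalSpace N]
  [IsTopologicalAddGroup N] [T2Space N] [CompactSpace N] [ContinuousConstSMul A N]

/-- In a compact module the solution sets of pp-formulas are closed: they are continuous images of
solution sets of systems of linear equations. -/
theorem PPFormula.isClosed_sol {ν : Type} [Fintype ν] (φ : PPFormula A ν) :
    IsClosed (φ.sol N : Set (ν → N)) := by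
  let Z : Set ((ν → N) × (Fin φ.bound → N)) :=
    {p | ∀ j, ∑ i, φ.mat i j • Sum.elim p.1 p.2 i = 0}
  have hZ : IsClosed Z := by
    simp only [Z, Set.ofPred_forall]
    refine isClosed_iInter fun j => isClosed_eq ?_ continuous_const
    refine continuous_finsetSum _ fun i _ => Continuous.const_smul ?_ _
    rcases i with i | i
    · exact (continuous_apply i).comp continuous_fst
    · exact (continuous_apply i).comp continuous_snd
  have : (φ.sol N : Set (ν → N)) = Prod.fst '' Z := by
    ext x
    constructor
    · rintro ⟨y, hy⟩
      exact ⟨(x, y), hy, rfl⟩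
    · rintro ⟨⟨x, y⟩, hy, rfl⟩
      exact ⟨y, hy⟩
  rw [this]
  exact (hZ.isCompact.image continuous_fst).isClosed

variable (A N) in
/-- Compact modules are algebraically compact, by Tychonoff's theorem. -/
theorem algCompact_of_compactSpace : AlgCompact A N := by
  intro V I P hP H
  have hclosed : ∀ i, IsClosed {h : V → N | P i N (Sum.elim h id)} := by
    intro i
    obtain ⟨c, hc⟩ := (hP i).exists_cond
    simp only [hc]
    refine IsClosed.preimage (f := fun h : V → N => Sum.elim h id ∘ c.var) ?_
      c.formula.isClosed_sol
    refine continuous_pi fun k => ?_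
    simp only [Function.comp_apply]
    rcases c.var k with x | x
    · exact continuous_apply x
    · exact continuous_const
  obtain ⟨h, hh⟩ := CompactSpace.iInter_nonempty (t := fun i => {h : V → N | P i N (Sum.elim h id)})
    hclosed (fun s => by
      obtain ⟨h, hh⟩ := H s
      exact ⟨h, Set.mem_iInter₂.2 hh⟩)
  exact ⟨h, fun i => Set.mem_iInter.1 hh i⟩

end Topology

/-- If `N` is algebraically compact and the family `j` satisfies in `N` all pp-conditions which the
family `i` satisfies in `X`, then some linear map sends `i` to `j`. -/
theorem AlgCompact.exists_linearMap {N X T : Type u} [AddCommGroup N] [Module A N]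
    [AddCommGroup X] [Module A X] (hN : AlgCompact A N) (i : T → X) (j : T → N)
    (H : ∀ c : PPCond A T, c.Holds i → c.Holds j) : ∃ g : X →ₗ[A] N, ∀ t, g (i t) = j t := by
  obtain ⟨h, hh⟩ := hN X {c : PPCond A (X ⊕ T) // c.Holds (Sum.elim id i)}
    (fun c M _ _ h => c.1.Holds (h ∘ Sum.map id j)) (fun c => c.1.ppDef.rename _) (by
      intro s
      have hs : PPDef A fun M _ _ (h : X ⊕ T → M) => ∀ c ∈ s, c.1.Holds h :=
        PPDef.forall_mem_finset s fun c _ => c.1.ppDef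
      obtain ⟨c, hc⟩ := hs.exists_family.exists_cond
      obtain ⟨z, hz⟩ := (hc N j).2 (H c ((hc X i).1 ⟨id, fun c _ => c.2⟩))
      refine ⟨z, fun c hcs => ?_⟩
      rw [Sum.elim_comp_map]
      exact hz c hcs)
  simp only [Sum.elim_comp_map, Function.comp_id, Function.id_comp] at hh
  obtain ⟨g, rfl⟩ := exists_linearMap_of_conds h fun c hc =>
    hh ⟨⟨c.arity, c.formula, Sum.inl ∘ c.var⟩, hc⟩
  refine ⟨g, fun t => ?_⟩
  obtain ⟨c, hc⟩ := (PPDef.eq (A := A) (Sum.inl (i t) : X ⊕ T) (Sum.inr t)).exists_cond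
  exact (hc _ _).2 (hh ⟨c, (hc _ _).1 rfl⟩)

theorem AlgCompact.isPureInjective {N : ModuleCat.{u} A} (hN : AlgCompact A N) :
    IsPureInjective N := by
  intro M f hf
  obtain ⟨g, hg⟩ := hN.exists_linearMap f.hom id fun c hc => hf.mem_sol c.formula c.var hc
  exact ⟨ModuleCat.ofHom g, by ext x; exact hg x⟩

variable (A) in
theorem Bidual.algCompact (M : Type u) [AddCommGroup M] [Module A M] : AlgCompact A (Bidual M) :=
  algCompact_of_compactSpace A (Bidual M)

end AlgCompact

/-! ### Interpretation functors on pp-formulas -/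

section Interpretation

variable {A B : Type u} [Ring A] [Ring B]
  {C : ObjectProperty (ModuleCat.{u} A)} {D : ObjectProperty (ModuleCat.{u} B)}

open Finsupp (linearCombination single)

/-- The data which present `I` as an interpretation functor. -/
structure Interpretation (I : C.FullSubcategory ⥤ D.FullSubcategory) where
  m : ℕ
  φ : PPFormula A (Fin m)
  ψ : PPFormula A (Fin m)
  ρ : B → PPFormula A (Fin m ⊕ Fin m)
  le : ∀ M : ModuleCat.{u} A, ψ.sol M ≤ φ.sol M
  e : ∀ M : C.FullSubcategory, PPQuotient φ ψ M.obj ≃+ (I.obj M).obj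
  e_map : ∀ (M N : C.FullSubcategory) (f : M ⟶ N) (x : φ.sol M.obj),
    (I.map f).hom.hom (e M (QuotientAddGroup.mk x)) =
      e N (QuotientAddGroup.mk ⟨f.hom.hom ∘ x.1, φ.map_mem_sol f.hom.hom x.2⟩)
  e_smul : ∀ (M : C.FullSubcategory) (b : B) (p q : PPQuotient φ ψ M.obj),
    b • e M p = e M q ↔
      ∃ x y : φ.sol M.obj, QuotientAddGroup.mk x = p ∧ QuotientAddGroup.mk y = q ∧
        Sum.elim x.1 y.1 ∈ (ρ b).sol M.obj

theorem IsInterpretationFunctor.nonempty {I : C.FullSubcategory ⥤ D.FullSubcategory}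
    (hI : IsInterpretationFunctor I) : Nonempty (Interpretation I) := by
  obtain ⟨m, φ, ψ, ρ, le, e, h1, h2⟩ := hI
  exact ⟨⟨m, φ, ψ, ρ, le, e, h1, h2⟩⟩

namespace Interpretation

variable {I : C.FullSubcategory ⥤ D.FullSubcategory} (T : Interpretation I)

/-- The tuple `x` lies in `φ(M)` and its class is the element `p` of `I M`. -/
def Rep (M : C.FullSubcategory) (x : Fin T.m → M.obj) (p : (I.obj M).obj) : Prop :=
  ∃ hx : x ∈ T.φ.sol M.obj, T.e M (QuotientAddGroup.mk ⟨x, hx⟩) = p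

variable {T} {M N : C.FullSubcategory} {x y : Fin T.m → M.obj} {p q : (I.obj M).obj}

variable (T) in
theorem exists_rep (p : (I.obj M).obj) : ∃ x, T.Rep M x p := by
  obtain ⟨c, rfl⟩ := (T.e M).surjective p
  obtain ⟨x, rfl⟩ := QuotientAddGroup.mk_surjective c
  exact ⟨x.1, x.2, rfl⟩

variable (T) in
theorem exists_class {x : Fin T.m → M.obj} (hx : x ∈ T.φ.sol M.obj) : ∃ p, T.Rep M x p :=
  ⟨_, hx, rfl⟩

theorem Rep.mem (h : T.Rep M x p) : x ∈ T.φ.sol M.obj := h.1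

theorem Rep.unique (h : T.Rep M x p) (h' : T.Rep M x q) : p = q :=
  h.2.symm.trans h'.2

theorem Rep.add (h : T.Rep M x p) (h' : T.Rep M y q) : T.Rep M (x + y) (p + q) := by
  obtain ⟨hx, rfl⟩ := h
  obtain ⟨hy, rfl⟩ := h'
  exact ⟨add_mem hx hy, (T.e M).map_add (QuotientAddGroup.mk ⟨x, hx⟩) (QuotientAddGroup.mk ⟨y, hy⟩)⟩

theorem Rep.neg (h : T.Rep M x p) : T.Rep M (-x) (-p) := by
  obtain ⟨hx, rfl⟩ := h
  exact ⟨neg_mem hx, (T.e M).map_neg (QuotientAddGroup.mk ⟨x, hx⟩)⟩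

theorem Rep.sub (h : T.Rep M x p) (h' : T.Rep M y q) : T.Rep M (x - y) (p - q) := by
  simpa only [sub_eq_add_neg] using h.add h'.neg

theorem rep_zero_iff : T.Rep M x 0 ↔ x ∈ T.ψ.sol M.obj := by
  constructor
  · rintro ⟨hx, h⟩
    rw [EmbeddingLike.map_eq_zero_iff, QuotientAddGroup.eq_zero_iff] at h
    exact h
  · intro h
    refine ⟨T.le M.obj h, ?_⟩
    rw [EmbeddingLike.map_eq_zero_iff, QuotientAddGroup.eq_zero_iff]
    exact h

theorem Rep.eq_iff (h : T.Rep M x p) (h' : T.Rep M y q) : p = q ↔ x - y ∈ T.ψ.sol M.obj := by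
  rw [← rep_zero_iff]
  constructor
  · rintro rfl
    simpa using h.sub h'
  · intro h0
    exact sub_eq_zero.1 ((h.sub h').unique h0)

theorem Rep.sum {W : Type*} {s : Finset W} {z : W → Fin T.m → M.obj} {r : W → (I.obj M).obj}
    (h : ∀ w ∈ s, T.Rep M (z w) (r w)) : T.Rep M (∑ w ∈ s, z w) (∑ w ∈ s, r w) := by
  classical
  induction s using Finset.induction_on with
  | empty => exact rep_zero_iff.2 (zero_mem _)
  | insert a s ha ih =>
    rw [Finset.sum_insert ha, Finset.sum_insert ha]
    exact (h a (Finset.mem_insert_self _ _)).add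
      (ih fun w hw => h w (Finset.mem_insert_of_mem hw))

theorem Rep.map (h : T.Rep M x p) (f : M ⟶ N) :
    T.Rep N (f.hom.hom ∘ x) ((I.map f).hom.hom p) := by
  obtain ⟨hx, rfl⟩ := h
  exact ⟨T.φ.map_mem_sol f.hom.hom hx, (T.e_map M N f ⟨x, hx⟩).symm⟩

theorem Rep.smul_iff {b : B} (h : T.Rep M x p) (h' : T.Rep M y q) :
    b • p = q ↔ ∃ z : Fin T.m ⊕ Fin T.m → M.obj, (z ∘ Sum.inl ∈ T.φ.sol M.obj ∧
      z ∘ Sum.inr ∈ T.φ.sol M.obj) ∧ (x - z ∘ Sum.inl ∈ T.ψ.sol M.obj ∧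
      y - z ∘ Sum.inr ∈ T.ψ.sol M.obj) ∧ z ∈ (T.ρ b).sol M.obj := by
  obtain ⟨hx, hp⟩ := id h
  obtain ⟨hy, hq⟩ := id h'
  rw [← hp, ← hq, T.e_smul]
  constructor
  · rintro ⟨x', y', hxx, hyy, hz⟩
    refine ⟨Sum.elim x'.1 y'.1, ⟨x'.2, y'.2⟩, ⟨?_, ?_⟩, hz⟩
    · rw [Sum.elim_comp_inl, ← h.eq_iff ⟨x'.2, rfl⟩, hxx, hp]
    · rw [Sum.elim_comp_inr, ← h'.eq_iff ⟨y'.2, rfl⟩, hyy, hq]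
  · rintro ⟨z, ⟨h1, h2⟩, ⟨h3, h4⟩, hz⟩
    refine ⟨⟨_, h1⟩, ⟨_, h2⟩, ?_, ?_, ?_⟩
    · rw [← (T.e M).apply_eq_iff_eq, hp]
      exact ((h.eq_iff ⟨h1, rfl⟩).2 h3).symm
    · rw [← (T.e M).apply_eq_iff_eq, hq]
      exact ((h'.eq_iff ⟨h2, rfl⟩).2 h4).symm
    · rw [Sum.elim_comp_inl_inr]
      exact hz

variable (T) in
/-- Scalar multiplication on `I M` is pp-definable in terms of representatives. -/
theorem exists_smul (b : B) :
    ∃ R : ∀ (M : Type u) [AddCommGroup M] [Module A M], (Fin T.m ⊕ Fin T.m → M) → Prop,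
      PPDef A R ∧ ∀ (M : C.FullSubcategory) (x y : Fin T.m → M.obj) (p q : (I.obj M).obj),
        T.Rep M x p → T.Rep M y q → (R M.obj (Sum.elim x y) ↔ b • p = q) := by
  have hψ : PPDef A fun M _ _ (h : Fin T.m → M) => h ∈ T.ψ.sol M := PPDef.of_formula T.ψ id
  have d (f : Fin T.m → Fin T.m ⊕ Fin T.m) :=
    hψ.subst (V := (Fin T.m ⊕ Fin T.m) ⊕ (Fin T.m ⊕ Fin T.m))
      fun i => single (Sum.inr (f i)) 1 - single (Sum.inl (f i)) 1
  refine ⟨_, (((PPDef.of_formula T.φ (Sum.inl ∘ Sum.inl)).and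
    (PPDef.of_formula T.φ (Sum.inl ∘ Sum.inr))).and
    (((d Sum.inl).and (d Sum.inr)).and (PPDef.of_formula (T.ρ b) Sum.inl))).exists_fintype,
    fun M x y p q h h' => ?_⟩
  rw [h.smul_iff h']
  refine exists_congr fun z => ?_
  rw [and_assoc (b := _ ∈ _)]
  simp only [map_sub, Finsupp.linearCombination_single, one_smul, Sum.elim_inl, Sum.elim_inr,
    ← Function.comp_assoc, Sum.elim_comp_inl, and_assoc]
  rfl

variable (T) in
/-- The vanishing of a linear combination in `I M` is pp-definable in terms of representatives. -/
theorem exists_linear {W : Type*} (l : W →₀ B) :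
    ∃ E : ∀ (M : Type u) [AddCommGroup M] [Module A M], (W × Fin T.m → M) → Prop,
      PPDef A E ∧ ∀ (M : C.FullSubcategory) (h : W → (I.obj M).obj) (x : W × Fin T.m → M.obj),
        (∀ w, T.Rep M (fun i => x (w, i)) (h w)) →
          (E M.obj x ↔ linearCombination B h l = 0) := by
  choose R hR hRiff using T.exists_smul
  have hψ : PPDef A fun M _ _ (h : Fin T.m → M) => h ∈ T.ψ.sol M := PPDef.of_formula T.ψ id
  have h1 := PPDef.forall_mem_finset l.support fun w _ =>
    PPDef.of_formula (V := (W × Fin T.m) ⊕ (W × Fin T.m)) T.φ fun i => Sum.inl (w, i)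
  have h2 := PPDef.forall_mem_finset l.support fun w _ =>
    (hR (l w)).rename (V := (W × Fin T.m) ⊕ (W × Fin T.m))
      (Sum.elim (fun i => Sum.inr (w, i)) fun i => Sum.inl (w, i))
  have h3 := hψ.subst (V := (W × Fin T.m) ⊕ (W × Fin T.m))
    fun i => ∑ w ∈ l.support, single (Sum.inl (w, i)) 1
  refine ⟨_, ((h1.and h2).and h3).exists_family, fun M h x hx => ?_⟩
  have e2 : ∀ (z : W × Fin T.m → M.obj) (w : W),
      Sum.elim z x ∘ Sum.elim (fun i => Sum.inr (w, i)) (fun i => Sum.inl (w, i)) =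
        Sum.elim (fun i => x (w, i)) fun i => z (w, i) := by
    intro z w
    ext i
    rcases i with i | i <;> rfl
  have e3 : ∀ z : W × Fin T.m → M.obj, (fun i => linearCombination A (Sum.elim z x)
      (∑ w ∈ l.support, single (Sum.inl (w, i)) 1)) = ∑ w ∈ l.support, fun i => z (w, i) := by
    intro z
    ext i
    simp [Finset.sum_apply]
  simp only [e2, e3]
  rw [Finsupp.linearCombination_apply, Finsupp.sum]
  constructor
  · rintro ⟨z, ⟨hz1, hz2⟩, hz3⟩
    have key : ∀ w ∈ l.support, T.Rep M (fun i => z (w, i)) (l w • h w) := by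
      intro w hw
      obtain ⟨r, hr⟩ := T.exists_class (hz1 w hw)
      rwa [(hRiff (l w) M _ _ _ _ (hx w) hr).1 (hz2 w hw)]
    exact (Rep.sum key).unique (rep_zero_iff.2 hz3)
  · intro h0
    choose z hz using fun w => T.exists_rep (l w • h w)
    refine ⟨fun k => z k.1 k.2, ⟨fun w _ => (hz w).mem, fun w _ => ?_⟩, ?_⟩
    · exact (hRiff (l w) M _ _ _ _ (hx w) (hz w)).2 rfl
    · rw [← rep_zero_iff, ← h0]
      exact Rep.sum fun w _ => hz w

variable (T) in
/-- pp-conditions in `I M` are pp-conditions on representatives in `M`. -/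
theorem exists_translate {V : Type*}
    {P : ∀ (M : Type u) [AddCommGroup M] [Module B M], (V → M) → Prop} (hP : PPDef B P) :
    ∃ E : ∀ (M : Type u) [AddCommGroup M] [Module A M], (V × Fin T.m → M) → Prop,
      PPDef A E ∧ ∀ (M : C.FullSubcategory) (h : V → (I.obj M).obj) (x : V × Fin T.m → M.obj),
        (∀ v, T.Rep M (fun i => x (v, i)) (h v)) → (E M.obj x ↔ P (I.obj M).obj h) := by
  obtain ⟨κ, ι, _, _, L, hL⟩ := hP
  choose E hE hEiff using fun j => T.exists_linear (L j)
  have h1 := PPDef.forall_fintype fun k : κ =>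
    PPDef.of_formula (V := (κ × Fin T.m) ⊕ (V × Fin T.m)) T.φ fun i => Sum.inl (k, i)
  have h2 := PPDef.forall_fintype fun j =>
    (hE j).rename (V := (κ × Fin T.m) ⊕ (V × Fin T.m)) fun w =>
      Sum.elim (fun v => Sum.inr (v, w.2)) (fun k => Sum.inl (k, w.2)) w.1
  refine ⟨_, (h1.and h2).exists_fintype, fun M h x hx => ?_⟩
  rw [hL]
  have key : ∀ (z : κ × Fin T.m → M.obj) (y : κ → (I.obj M).obj),
      (∀ k, T.Rep M (fun i => z (k, i)) (y k)) → ∀ j,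
      (E j M.obj (Sum.elim z x ∘ fun w : (V ⊕ κ) × Fin T.m =>
        Sum.elim (fun v => Sum.inr (v, w.2)) (fun k => Sum.inl (k, w.2)) w.1) ↔
        linearCombination B (Sum.elim h y) (L j) = 0) := by
    intro z y hzy j
    refine hEiff j M _ _ ?_
    rintro (v | k)
    · exact hx v
    · exact hzy k
  constructor
  · rintro ⟨z, hz1, hz2⟩
    choose y hy using fun k => T.exists_class (hz1 k)
    exact ⟨y, fun j => (key z y hy j).1 (hz2 j)⟩
  · rintro ⟨y, hy⟩
    choose z hz using fun k => T.exists_rep (y k)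
    exact ⟨fun k => z k.1 k.2, fun k => (hz k).mem,
      fun j => (key (fun k => z k.1 k.2) y hz j).2 (hy j)⟩

/-- Interpretation functors preserve algebraic compactness. -/
theorem algCompact (T : Interpretation I) (hM : AlgCompact A M.obj) :
    AlgCompact B (I.obj M).obj := by
  classical
  intro V J P hP H
  choose ℓ hℓ using fun p : (I.obj M).obj => T.exists_rep p
  choose E hE hEiff using fun j => T.exists_translate (hP j)
  let θ : (V ⊕ (I.obj M).obj) × Fin T.m → (V × Fin T.m) ⊕ M.obj := fun w =>
    Sum.elim (fun v => Sum.inl (v, w.2)) (fun p => Sum.inr (ℓ p w.2)) w.1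
  have key : ∀ (h : V → (I.obj M).obj) (x : V × Fin T.m → M.obj),
      (∀ v, T.Rep M (fun i => x (v, i)) (h v)) → ∀ j,
      (E j M.obj (Sum.elim x id ∘ θ) ↔ P j (I.obj M).obj (Sum.elim h id)) := by
    intro h x hx j
    refine hEiff j M _ _ ?_
    rintro (v | p)
    · exact hx v
    · exact hℓ p
  obtain ⟨x, hx⟩ := hM (V × Fin T.m) (J ⊕ V)
    (fun k => k.elim (fun j M _ _ x => E j M (x ∘ θ))
      fun v M _ _ x => (x ∘ fun i => Sum.inl (v, i)) ∈ T.φ.sol M) (by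
      rintro (j | v)
      · exact (hE j).rename θ
      · exact PPDef.of_formula T.φ fun i => Sum.inl (v, i)) (by
      intro s
      obtain ⟨h, hh⟩ := H s.toLeft
      choose x hx using fun v => T.exists_rep (h v)
      refine ⟨fun k => x k.1 k.2, ?_⟩
      rintro (j | v) hj
      · exact (key h (fun k => x k.1 k.2) hx j).2 (hh j (Finset.mem_toLeft.2 hj))
      · exact (hx v).mem)
  choose h hh using fun v => T.exists_class (hx (Sum.inr v))
  exact ⟨h, fun j => (key h x hh j).1 (hx (Sum.inl j))⟩

end Interpretation

end Interpretation

/-! ### The lattice of pp-formulas of the target as an interval -/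

section Interval

variable {A B : Type u} [Ring A] [Ring B]
  {C : ObjectProperty (ModuleCat.{u} A)} {D : ObjectProperty (ModuleCat.{u} B)}

theorem PPLattice.mk_le_mk {ν : Type} [Fintype ν] {X : ObjectProperty (ModuleCat.{u} A)}
    {σ τ : PPFormula A ν} :
    PPLattice.mk X σ ≤ PPLattice.mk X τ ↔ ∀ M : ModuleCat.{u} A, X M → σ.sol M ≤ τ.sol M :=
  Iff.rfl

theorem PPLattice.mk_eq_mk {ν : Type} [Fintype ν] {X : ObjectProperty (ModuleCat.{u} A)}
    {σ τ : PPFormula A ν} :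
    PPLattice.mk X σ = PPLattice.mk X τ ↔ ∀ M : ModuleCat.{u} A, X M → σ.sol M = τ.sol M :=
  Quotient.eq (r := PPFormula.setoidOn ν X)

theorem PPLattice.mk_inf {ν : Type} [Fintype ν] (X : ObjectProperty (ModuleCat.{u} A))
    (σ τ : PPFormula A ν) :
    PPLattice.mk X σ ⊓ PPLattice.mk X τ = PPLattice.mk X (σ.conj τ) := rfl

instance {ν : Type} [Fintype ν] {X : ObjectProperty (ModuleCat.{u} A)} :
    IsModularLattice (PPLattice ν X) where
  sup_inf_le_assoc_of_le := by
    intro x y z hxz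
    induction x using PPLattice.ind with | _ σ
    induction y using PPLattice.ind with | _ τ
    induction z using PPLattice.ind with | _ υ
    intro M hM
    change ((σ.add τ).conj υ).sol M ≤ (σ.add (τ.conj υ)).sol M
    rw [PPFormula.sol_conj, PPFormula.sol_add, PPFormula.sol_add, PPFormula.sol_conj]
    exact IsModularLattice.sup_inf_le_assoc_of_le _ (hxz M hM)

namespace Interpretation

variable {I : C.FullSubcategory ⥤ D.FullSubcategory} (T : Interpretation I)

theorem exists_star (σ : PPFormula B (Fin 1)) :
    ∃ σ' : PPFormula A (Fin T.m), ∀ (M : C.FullSubcategory) (x : Fin T.m → M.obj),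
      x ∈ σ'.sol M.obj ↔ ∃ p, T.Rep M x p ∧ (fun _ => p) ∈ σ.sol (I.obj M).obj := by
  obtain ⟨E, hE, hiff⟩ := T.exists_translate (PPDef.of_formula (V := Fin 1) σ id)
  obtain ⟨σ', hσ'⟩ := ((PPDef.of_formula T.φ id).and (hE.rename Prod.snd)).exists_formula
  refine ⟨σ', fun M x => ?_⟩
  rw [hσ']
  constructor
  · rintro ⟨hx, h⟩
    obtain ⟨p, hp⟩ := T.exists_class hx
    exact ⟨p, hp, (hiff M (fun _ => p) (x ∘ Prod.snd) fun _ => hp).1 h⟩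
  · rintro ⟨p, hp, h⟩
    exact ⟨hp.mem, (hiff M (fun _ => p) (x ∘ Prod.snd) fun _ => hp).2 h⟩

/-- The formula `σ*` over `A` between `ψ` and `φ` which defines in `M` the preimage of the solution
set of the formula `σ` over `B` in `I M`. -/
noncomputable def star (σ : PPFormula B (Fin 1)) : PPFormula A (Fin T.m) :=
  (T.exists_star σ).choose

variable {T} {M : C.FullSubcategory} {x : Fin T.m → M.obj} {p : (I.obj M).obj}
  {σ τ : PPFormula B (Fin 1)}

theorem mem_star : x ∈ (T.star σ).sol M.obj ↔
    ∃ p, T.Rep M x p ∧ (fun _ => p) ∈ σ.sol (I.obj M).obj :=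
  (T.exists_star σ).choose_spec M x

theorem Rep.mem_star (h : T.Rep M x p) :
    x ∈ (T.star σ).sol M.obj ↔ (fun _ => p) ∈ σ.sol (I.obj M).obj := by
  rw [Interpretation.mem_star]
  constructor
  · rintro ⟨q, hq, hmem⟩
    rwa [h.unique hq]
  · exact fun hp => ⟨p, h, hp⟩

theorem star_le : (T.star σ).sol M.obj ≤ T.φ.sol M.obj := by
  intro x hx
  obtain ⟨p, hp, _⟩ := Interpretation.mem_star.1 hx
  exact hp.mem

theorem le_star : T.ψ.sol M.obj ≤ (T.star σ).sol M.obj := fun _ hx =>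
  Interpretation.mem_star.2 ⟨0, rep_zero_iff.2 hx, zero_mem (σ.sol _)⟩

theorem star_mono (h : σ.sol (I.obj M).obj ≤ τ.sol (I.obj M).obj) :
    (T.star σ).sol M.obj ≤ (T.star τ).sol M.obj := by
  intro x hx
  obtain ⟨p, hp, hpσ⟩ := Interpretation.mem_star.1 hx
  exact Interpretation.mem_star.2 ⟨p, hp, h hpσ⟩

theorem le_of_star_le (h : (T.star σ).sol M.obj ≤ (T.star τ).sol M.obj) :
    σ.sol (I.obj M).obj ≤ τ.sol (I.obj M).obj := by
  intro y hy
  obtain ⟨x, hx⟩ := T.exists_rep (y 0)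
  have hy0 : y = fun _ => y 0 := funext fun i => congrArg y (Subsingleton.elim i 0)
  rw [hy0] at hy ⊢
  exact hx.mem_star.1 (h (hx.mem_star.2 hy))

theorem star_conj : (T.star (σ.conj τ)).sol M.obj =
    (T.star σ).sol M.obj ⊓ (T.star τ).sol M.obj := by
  ext x
  rw [AddSubgroup.mem_inf]
  by_cases hx : x ∈ T.φ.sol M.obj
  · obtain ⟨p, hp⟩ := T.exists_class hx
    rw [hp.mem_star, hp.mem_star, hp.mem_star, PPFormula.sol_conj, AddSubgroup.mem_inf]
  · exact ⟨fun h => absurd (star_le h) hx, fun h => absurd (star_le h.1) hx⟩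

theorem star_add : (T.star (σ.add τ)).sol M.obj =
    (T.star σ).sol M.obj ⊔ (T.star τ).sol M.obj := by
  apply le_antisymm
  · intro x hx
    obtain ⟨p, hp, hpσ⟩ := Interpretation.mem_star.1 hx
    rw [PPFormula.sol_add, AddSubgroup.mem_sup] at hpσ
    obtain ⟨y, hy, z, hz, hyz⟩ := hpσ
    obtain ⟨x₁, hx₁⟩ := T.exists_rep (y 0)
    have hy0 : y = fun _ => y 0 := funext fun i => congrArg y (Subsingleton.elim i 0)
    have hz0 : z = fun _ => z 0 := funext fun i => congrArg z (Subsingleton.elim i 0)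
    have hp0 : y 0 + z 0 = p := congrFun hyz 0
    rw [hy0] at hy
    rw [hz0] at hz
    refine AddSubgroup.mem_sup.2 ⟨x₁, hx₁.mem_star.2 hy, x - x₁, ?_, by abel⟩
    have := hp.sub hx₁
    rw [← hp0, add_sub_cancel_left] at this
    exact this.mem_star.2 hz
  · refine sup_le (star_mono ?_) (star_mono ?_)
    · rw [PPFormula.sol_add]
      exact le_sup_left
    · rw [PPFormula.sol_add]
      exact le_sup_right

/-- If `I` is full on pure-injectives then every pp-formula between `ψ` and `φ` is of the form `σ*`
on `C`. Otherwise there are `M` and `N` in `C`, which may be taken to be compact, an element `a` of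
`θ(M)` with the least possible pp-type, and an element `b` of `N` outside of `θ(N)` whose class
satisfies in `I N` all the pp-formulas satisfied by the class of `a` in `I M`. Then some
homomorphism `I M ⟶ I N` maps the class of `a` to the class of `b`, and it cannot be of the form
`I f`. -/
theorem exists_star_eq (T : Interpretation I) (hC : IsDefinable C)
    (hfull : IsFullOnPureInjectives I)
    (θ : PPFormula A (Fin T.m))
    (hψθ : ∀ M : C.FullSubcategory, T.ψ.sol M.obj ≤ θ.sol M.obj)
    (hθφ : ∀ M : C.FullSubcategory, θ.sol M.obj ≤ T.φ.sol M.obj) :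
    ∃ σ : PPFormula B (Fin 1), ∀ M : C.FullSubcategory, (T.star σ).sol M.obj = θ.sol M.obj := by
  by_contra! hcon
  have hθ : PPDef A fun M _ _ (h : Fin T.m → M) => h ∈ θ.sol M := PPDef.of_formula θ id
  -- `a` is generic in `θ`
  obtain ⟨M, hM, a, ha, haχ⟩ := hC.exists_realization (V := Fin T.m) (κ := PUnit)
    (ι := {χ : PPFormula A (Fin T.m) // ¬ ∀ M : C.FullSubcategory, θ.sol M.obj ≤ χ.sol M.obj})
    (P := fun _ M _ _ h => h ∈ θ.sol M) (Q := fun χ M _ _ h => h ∈ χ.1.sol M)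
    (fun _ => hθ) (fun χ => PPDef.of_formula χ.1 id) (by
      rintro s ⟨χ, hχ⟩
      push Not at hχ
      obtain ⟨M, hM⟩ := hχ
      obtain ⟨x, hx, hxχ⟩ := SetLike.not_le_iff_exists.1 hM
      exact ⟨M.obj, M.property, x, fun _ _ => hx, hxχ⟩)
  have haχ' : ∀ χ : PPFormula A (Fin T.m), a ∈ χ.sol M →
      ∀ M : C.FullSubcategory, θ.sol M.obj ≤ χ.sol M.obj := by
    intro χ hχ
    by_contra hne
    exact haχ ⟨χ, hne⟩ hχ
  -- `b` lies in every `σ*` containing `θ` but not in `θ`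
  obtain ⟨N, hN, b, hb, hbθ⟩ := hC.exists_realization (V := Fin T.m)
    (κ := {σ : PPFormula B (Fin 1) // ∀ M : C.FullSubcategory,
      θ.sol M.obj ≤ (T.star σ).sol M.obj}) (ι := PUnit)
    (P := fun σ M _ _ h => h ∈ (T.star σ.1).sol M) (Q := fun _ M _ _ h => h ∈ θ.sol M)
    (fun σ => PPDef.of_formula (T.star σ.1) id) (fun _ => hθ) (by
      rintro s -
      obtain ⟨σ₀, hσ₀⟩ := (PPDef.forall_mem_finset s fun σ _ =>
        PPDef.of_formula (V := Fin 1) σ.1 id).exists_formula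
      have h0 : ∀ M : C.FullSubcategory, θ.sol M.obj ≤ (T.star σ₀).sol M.obj := by
        intro M x hx
        obtain ⟨p, hp⟩ := T.exists_class (hθφ M hx)
        rw [hp.mem_star, hσ₀]
        exact fun σ _ => hp.mem_star.1 (σ.2 M hx)
      obtain ⟨M, hM⟩ := hcon σ₀
      obtain ⟨x, hx, hxθ⟩ := SetLike.not_le_iff_exists.1 fun hle => hM (le_antisymm hle (h0 M))
      refine ⟨M.obj, M.property, x, fun σ hσ => ?_, hxθ⟩
      exact star_mono (fun y hy => (hσ₀ _ _).1 hy σ hσ) hx)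
  have hbθ := hbθ PUnit.unit
  have ha := ha PUnit.unit
  let M' : C.FullSubcategory := ⟨ModuleCat.of A (Bidual M), Bidual.mem_of_isDefinable hC hM⟩
  let N' : C.FullSubcategory := ⟨ModuleCat.of A (Bidual N), Bidual.mem_of_isDefinable hC hN⟩
  let a' : Fin T.m → M'.obj := Bidual.eval A M ∘ a
  let b' : Fin T.m → N'.obj := Bidual.eval A N ∘ b
  have ha' : ∀ χ : PPFormula A (Fin T.m), a' ∈ χ.sol M'.obj ↔ a ∈ χ.sol M := fun χ =>
    Bidual.eval_mem_sol_iff χ a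
  have hb' : ∀ χ : PPFormula A (Fin T.m), b' ∈ χ.sol N'.obj ↔ b ∈ χ.sol N := fun χ =>
    Bidual.eval_mem_sol_iff χ b
  obtain ⟨p, hp⟩ := T.exists_class ((ha' _).2 (hθφ ⟨M, hM⟩ ha))
  have htype : ∀ σ : PPFormula B (Fin 1), (fun _ => p) ∈ σ.sol (I.obj M').obj →
      b' ∈ (T.star σ).sol N'.obj := by
    intro σ hσ
    rw [hb']
    exact hb ⟨σ, haχ' _ ((ha' _).1 (hp.mem_star.2 hσ))⟩
  obtain ⟨q, hq⟩ : ∃ q, T.Rep N' b' q := by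
    obtain ⟨σ, hσ⟩ := (PPDef.true (A := B) (V := Fin 1)).exists_formula
    exact T.exists_class (star_le (htype σ ((hσ _ _).2 trivial)))
  have hNcomp : AlgCompact A N'.obj := Bidual.algCompact A N
  obtain ⟨g, hg⟩ := (T.algCompact hNcomp).exists_linearMap (T := PUnit.{u + 1})
    (X := (I.obj M').obj) (fun _ => p) (fun _ => q) (by
      intro c hc
      obtain ⟨σ, hσ⟩ := (c.ppDef.rename (V := Fin 1) fun _ => 0).exists_formula
      have h1 := htype σ ((hσ _ _).2 hc)
      rw [hq.mem_star, hσ] at h1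
      exact h1)
  obtain ⟨f, hf⟩ := hfull M' N' (Bidual.algCompact A M).isPureInjective
    (Bidual.algCompact A N).isPureInjective (ObjectProperty.homMk (ModuleCat.ofHom g))
  have hfa : T.Rep N' (f.hom.hom ∘ a') q := by
    have h1 := hp.map f
    rw [hf] at h1
    have h2 : (ObjectProperty.homMk (P := D) (X := I.obj M') (Y := I.obj N')
      (ModuleCat.ofHom g)).hom.hom p = q := hg PUnit.unit
    rwa [h2] at h1
  refine hbθ ((hb' θ).1 ?_)
  have h1 : b' - f.hom.hom ∘ a' ∈ θ.sol N'.obj := hψθ N' ((hq.eq_iff hfa).1 rfl)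
  have h2 : f.hom.hom ∘ a' ∈ θ.sol N'.obj := θ.map_mem_sol f.hom.hom ((ha' θ).2 ha)
  simpa using add_mem h1 h2

variable (T) in
/-- The map `σ ↦ σ*` from the lattice of pp-formulas over `D` to the lattice of pp-formulas
over `C`. -/
noncomputable def starHom : LatticeHom (PPLattice (Fin 1) D) (PPLattice (Fin T.m) C) where
  toFun := Quotient.map (sa := PPFormula.setoidOn (Fin 1) D) (sb := PPFormula.setoidOn (Fin T.m) C)
    T.star fun σ τ h M hM => le_antisymm
      (star_mono (M := ⟨M, hM⟩) (h _ (I.obj ⟨M, hM⟩).property).le)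
      (star_mono (M := ⟨M, hM⟩) (h _ (I.obj ⟨M, hM⟩).property).ge)
  map_sup' a b := by
    induction a using PPLattice.ind with | _ σ
    induction b using PPLattice.ind with | _ τ
    exact PPLattice.mk_eq_mk.2 fun M hM =>
      (star_add (M := ⟨M, hM⟩)).trans (PPFormula.sol_add _ _ M).symm
  map_inf' a b := by
    induction a using PPLattice.ind with | _ σ
    induction b using PPLattice.ind with | _ τ
    exact PPLattice.mk_eq_mk.2 fun M hM =>
      (star_conj (M := ⟨M, hM⟩)).trans (PPFormula.sol_conj _ _ M).symm

theorem starHom_mk (σ : PPFormula B (Fin 1)) :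
    T.starHom (PPLattice.mk D σ) = PPLattice.mk C (T.star σ) := rfl

/-- Distinct formulas over `D` have distinct pullbacks, because `I C` generates `D`. -/
theorem starHom_injective (T : Interpretation I) (hgen : definableClosure (imageClass I) = D) :
    Function.Injective T.starHom := by
  have key : ∀ σ τ : PPFormula B (Fin 1),
      (∀ M : ModuleCat.{u} A, C M → (T.star σ).sol M = (T.star τ).sol M) →
      ∀ N : ModuleCat.{u} B, D N → σ.sol N ≤ τ.sol N := by
    intro σ τ h N hN
    rw [← hgen] at hN
    refine sol_le_of_definableClosure ?_ N hN
    rintro _ ⟨M, rfl⟩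
    exact le_of_star_le (h M.obj M.property).le
  intro a b hab
  induction a using PPLattice.ind with | _ σ
  induction b using PPLattice.ind with | _ τ
  rw [starHom_mk, starHom_mk, PPLattice.mk_eq_mk] at hab
  exact PPLattice.mk_eq_mk.2 fun N hN => le_antisymm (key σ τ hab N hN)
    (key τ σ (fun M hM => (hab M hM).symm) N hN)

theorem starHom_surjOn (T : Interpretation I) (hC : IsDefinable C)
    (hfull : IsFullOnPureInjectives I) {y : PPLattice (Fin T.m) C}
    (h₁ : PPLattice.mk C T.ψ ≤ y) (h₂ : y ≤ PPLattice.mk C T.φ) : ∃ a, T.starHom a = y := by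
  induction y using PPLattice.ind with | _ θ
  obtain ⟨σ, hσ⟩ := T.exists_star_eq hC hfull θ (fun M => h₁ M.obj M.property)
    (fun M => h₂ M.obj M.property)
  exact ⟨PPLattice.mk D σ, PPLattice.mk_eq_mk.2 fun M hM => hσ ⟨M, hM⟩⟩

theorem starHom_intervalSurjective (T : Interpretation I) (hC : IsDefinable C)
    (hfull : IsFullOnPureInjectives I) (hgen : definableClosure (imageClass I) = D) :
    IntervalSurjective T.starHom := by
  refine intervalSurjective_of_convex (T.starHom_injective hgen) fun a b y hay hyb =>
    T.starHom_surjOn hC hfull (le_trans ?_ hay) (le_trans hyb ?_)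
  · induction a using PPLattice.ind with | _ σ
    exact fun M hM => le_star (M := ⟨M, hM⟩)
  · induction b using PPLattice.ind with | _ σ
    exact fun M hM => star_le (M := ⟨M, hM⟩)

end Interpretation

end Interval

/-! ### Change of variables -/

section Pull

variable {A : Type u} [Ring A] {X : ObjectProperty (ModuleCat.{u} A)}
  {ν ν' : Type} [Fintype ν] [Fintype ν']

open Finsupp (linearCombination single)

/-- The formula `σ(x ∘ f)`, in which the variables not in the range of `f` are dummies. -/
noncomputable def PPFormula.pull (f : ν → ν') (σ : PPFormula A ν) : PPFormula A ν' :=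
  (PPDef.of_formula σ f).exists_formula.choose

theorem PPFormula.mem_pull {f : ν → ν'} {σ : PPFormula A ν} {M : Type u} [AddCommGroup M]
    [Module A M] {x : ν' → M} : x ∈ (σ.pull f).sol M ↔ x ∘ f ∈ σ.sol M :=
  (PPDef.of_formula σ f).exists_formula.choose_spec M x

namespace PPLattice

variable {f : ν → ν'} (hf : Function.Injective f)

variable (X) in
/-- Adding dummy variables, as a map of lattices of pp-formulas. -/
noncomputable def pullHom : LatticeHom (PPLattice ν X) (PPLattice ν' X) where
  toFun := Quotient.map (sa := PPFormula.setoidOn ν X) (sb := PPFormula.setoidOn ν' X)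
    (PPFormula.pull f) fun σ τ h M hM => by
      ext x
      rw [PPFormula.mem_pull, PPFormula.mem_pull, h M hM]
  map_sup' a b := by
    induction a using PPLattice.ind with | _ σ
    induction b using PPLattice.ind with | _ τ
    refine mk_eq_mk.2 fun M _ => le_antisymm (fun x hx => ?_) fun x hx => ?_
    · rw [PPFormula.mem_pull, PPFormula.sol_add, AddSubgroup.mem_sup] at hx
      obtain ⟨y, hy, z, hz, hyz⟩ := hx
      have hext : Function.extend f y x ∘ f = y := Function.extend_comp hf y x
      rw [PPFormula.sol_add]
      refine AddSubgroup.mem_sup.2 ⟨Function.extend f y x, ?_, x - Function.extend f y x, ?_,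
        by abel⟩
      · rwa [PPFormula.mem_pull, hext]
      · have : (x - Function.extend f y x) ∘ f = z := by
          rw [Pi.sub_comp, hext, ← hyz, add_sub_cancel_left]
        rwa [PPFormula.mem_pull, this]
    · rw [PPFormula.sol_add, AddSubgroup.mem_sup] at hx
      obtain ⟨y, hy, z, hz, rfl⟩ := hx
      rw [PPFormula.mem_pull] at hy hz ⊢
      rw [PPFormula.sol_add]
      exact AddSubgroup.mem_sup.2 ⟨_, hy, _, hz, rfl⟩
  map_inf' a b := by
    induction a using PPLattice.ind with | _ σ
    induction b using PPLattice.ind with | _ τ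
    refine mk_eq_mk.2 fun M _ => ?_
    ext x
    rw [PPFormula.mem_pull, PPFormula.sol_conj, PPFormula.sol_conj, AddSubgroup.mem_inf,
      AddSubgroup.mem_inf, PPFormula.mem_pull, PPFormula.mem_pull]

theorem pullHom_mk (σ : PPFormula A ν) : pullHom X hf (mk X σ) = mk X (σ.pull f) := rfl

theorem pullHom_injective : Function.Injective (pullHom X hf) := by
  intro a b hab
  induction a using PPLattice.ind with | _ σ
  induction b using PPLattice.ind with | _ τ
  rw [pullHom_mk, pullHom_mk, mk_eq_mk] at hab
  refine mk_eq_mk.2 fun M hM => ?_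
  ext y
  have hext : Function.extend f y 0 ∘ f = y := Function.extend_comp hf y 0
  rw [← hext, ← PPFormula.mem_pull, ← PPFormula.mem_pull, hab M hM]

/-- The image of `pullHom` consists of the formulas which contain the subgroup `x ∘ f = 0`. -/
theorem pullHom_intervalSurjective : IntervalSurjective (pullHom X hf) := by
  classical
  refine intervalSurjective_of_convex (pullHom_injective hf) fun a _ y hay _ => ?_
  induction a using PPLattice.ind with | _ σ
  induction y using PPLattice.ind with | _ θ
  obtain ⟨χ, hχ⟩ := ((PPDef.of_formula θ id).subst (V := ν) (W := ν')
    (Function.extend f (fun i => single i 1) 0)).exists_formula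
  have hext : ∀ (M : Type u) [AddCommGroup M] [Module A M] (h : ν → M),
      (fun k => linearCombination A h (Function.extend f (fun i => single i (1 : A)) 0 k)) =
        Function.extend f h 0 := by
    intro M _ _ h
    ext k
    by_cases hk : ∃ i, f i = k
    · obtain ⟨i, rfl⟩ := hk
      rw [hf.extend_apply, hf.extend_apply, Finsupp.linearCombination_single, one_smul]
    · rw [Function.extend_apply' _ _ _ hk, Function.extend_apply' _ _ _ hk]
      simp
  simp only [hext, Function.comp_id] at hχ
  refine ⟨mk X χ, mk_eq_mk.2 fun M hM => ?_⟩
  ext x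
  rw [PPFormula.mem_pull, hχ]
  have h0 : x - Function.extend f (x ∘ f) 0 ∈ θ.sol M := by
    refine hay M hM (PPFormula.mem_pull.2 ?_)
    rw [Pi.sub_comp, Function.extend_comp hf, sub_self]
    exact zero_mem (σ.sol M)
  constructor
  · intro h
    simpa using add_mem h0 h
  · intro h
    simpa using sub_mem h h0

end PPLattice

/-- If all the pp-formulas in one variable are collapsed, so are those in finitely many
variables. -/
theorem Collapses.of_one {𝓛 : Set Lat.{u}} (h𝓛 : IsClosedLatticeClass 𝓛) {γ : Ordinal.{u}}
    (h : Collapses 𝓛 (PPLattice (Fin 1) X) γ) (m : ℕ) : Collapses 𝓛 (PPLattice (Fin m) X) γ := by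
  obtain ⟨t, ht⟩ := (PPDef.true (A := A) (V := Fin 1)).exists_formula
  obtain ⟨z, hz⟩ := (PPDef.linear (A := A) (single (0 : Fin 1) 1)).exists_formula
  obtain ⟨u, hu⟩ := (PPDef.true (A := A) (V := Fin m)).exists_formula
  simp only [Finsupp.linearCombination_single, one_smul] at hz
  set c := collapseIter 𝓛 (PPLattice (Fin m) X) γ
  have key : ∀ s : Finset (Fin m), ∃ θ : PPFormula A (Fin m),
      (∀ (M : Type u) [AddCommGroup M] [Module A M] (x : Fin m → M),
        x ∈ θ.sol M ↔ ∀ i ∈ s, x i = 0) ∧ c.r (PPLattice.mk X u) (PPLattice.mk X θ) := by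
    classical
    intro s
    induction s using Finset.induction_on with
    | empty => exact ⟨u, fun M _ _ x => by simp [hu], Setoid.refl' _ _⟩
    | insert i s _ ih =>
      obtain ⟨θ, hθ, hr⟩ := ih
      have hi : Function.Injective fun _ : Fin 1 => i := Function.injective_of_subsingleton _
      have h1 := (PPLattice.pullHom_intervalSurjective (X := X) hi).collapseIter_map h𝓛
        (h (PPLattice.mk X t) (PPLattice.mk X z))
      rw [PPLattice.pullHom_mk, PPLattice.pullHom_mk] at h1
      refine ⟨θ.conj (z.pull fun _ => i), fun M _ _ x => ?_, ?_⟩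
      · rw [PPFormula.sol_conj, AddSubgroup.mem_inf, PPFormula.mem_pull, hθ, hz,
          Finset.forall_mem_insert, and_comm]
        rfl
      · have h2 := c.inf hr h1
        have h3 : PPLattice.mk X u ⊓ PPLattice.mk X (t.pull fun _ => i) = PPLattice.mk X u :=
          inf_eq_left.2 fun M _ x _ => PPFormula.mem_pull.2 ((ht M _).2 trivial)
        rwa [h3, PPLattice.mk_inf] at h2
  obtain ⟨θ, hθ, hr⟩ := key Finset.univ
  have hθ0 : ∀ a, PPLattice.mk X θ ≤ a := by
    intro a
    induction a using PPLattice.ind with | _ σ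
    intro M hM x hx
    have : x = 0 := funext fun i => (hθ M x).1 hx i (Finset.mem_univ i)
    rw [this]
    exact zero_mem (σ.sol M)
  have hu1 : ∀ a, a ≤ PPLattice.mk X u := by
    intro a
    induction a using PPLattice.ind with | _ σ
    exact fun M _ x _ => (hu M x).2 trivial
  have h0 : ∀ a, c.r a (PPLattice.mk X θ) := fun a => by
    have := c.inf (Setoid.refl' c.toSetoid a) hr
    rwa [inf_eq_left.2 (hu1 a), inf_eq_right.2 (hθ0 a)] at this
  exact fun a b => Setoid.trans' _ (h0 a) (Setoid.symm' _ (h0 b))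

/-- The formula `∃ y, Γ(x, y) ∧ φ(y)`. -/
noncomputable def PPFormula.image (Γ : PPFormula A (ν ⊕ ν')) (φ : PPFormula A ν') :
    PPFormula A ν :=
  ((PPDef.of_formula (V := ν' ⊕ ν) Γ Sum.swap).and
    (PPDef.of_formula φ Sum.inl)).exists_fintype.exists_formula.choose

theorem PPFormula.mem_image {Γ : PPFormula A (ν ⊕ ν')} {φ : PPFormula A ν'} {M : Type u}
    [AddCommGroup M] [Module A M] {x : ν → M} :
    x ∈ (Γ.image φ).sol M ↔ ∃ y, Sum.elim x y ∈ Γ.sol M ∧ y ∈ φ.sol M := by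
  refine (((PPDef.of_formula (V := ν' ⊕ ν) Γ Sum.swap).and
    (PPDef.of_formula φ Sum.inl)).exists_fintype.exists_formula.choose_spec M x).trans ?_
  refine exists_congr fun y => ?_
  have : Sum.elim y x ∘ Sum.swap = Sum.elim x y := by
    ext i; rcases i with i | i <;> rfl
  rw [this, Sum.elim_comp_inl]

/-- If the interval between two pp-formulas is collapsed then so is the one between their images
under a pp-definable relation. -/
theorem collapseIter_image {𝓛 : Set Lat.{u}} (h𝓛 : IsClosedLatticeClass 𝓛) {γ : Ordinal.{u}}
    {φ ψ : PPFormula A ν'}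
    (h : (collapseIter 𝓛 (PPLattice ν' X) γ).r (PPLattice.mk X ψ) (PPLattice.mk X φ))
    (Γ : PPFormula A (ν ⊕ ν')) :
    (collapseIter 𝓛 (PPLattice ν X) γ).r (PPLattice.mk X (Γ.image ψ))
      (PPLattice.mk X (Γ.image φ)) := by
  obtain ⟨z, hz⟩ := (PPDef.forall_fintype fun i : ν =>
    PPDef.linear (A := A) (single (Sum.inl i : ν ⊕ ν') 1)).exists_formula
  simp only [Finsupp.linearCombination_single, one_smul] at hz
  have hl : Function.Injective (Sum.inl : ν → ν ⊕ ν') := Sum.inl_injective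
  have hr : Function.Injective (Sum.inr : ν' → ν ⊕ ν') := Sum.inr_injective
  -- projecting to `x` amounts to adding the subgroup `x = 0`
  have key : ∀ χ : PPFormula A ν', PPLattice.pullHom X hl (PPLattice.mk X (Γ.image χ)) =
      (PPLattice.mk X Γ ⊓ PPLattice.pullHom X hr (PPLattice.mk X χ)) ⊔ PPLattice.mk X z := by
    intro χ
    refine PPLattice.mk_eq_mk.2 fun M _ => ?_
    ext w
    rw [PPFormula.mem_pull, PPFormula.mem_image, PPFormula.sol_add, AddSubgroup.mem_sup]
    constructor
    · rintro ⟨y, hy, hyχ⟩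
      refine ⟨Sum.elim (w ∘ Sum.inl) y, ?_, w - Sum.elim (w ∘ Sum.inl) y, ?_, by abel⟩
      · rw [PPFormula.sol_conj, AddSubgroup.mem_inf, PPFormula.mem_pull, Sum.elim_comp_inr]
        exact ⟨hy, hyχ⟩
      · rw [hz]
        intro i
        simp
    · rintro ⟨y, hy, v, hv, rfl⟩
      rw [PPFormula.sol_conj, AddSubgroup.mem_inf, PPFormula.mem_pull] at hy
      rw [hz] at hv
      refine ⟨y ∘ Sum.inr, ?_, hy.2⟩
      have : (y + v) ∘ Sum.inl = y ∘ Sum.inl := by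
        ext i
        simp [hv i]
      rw [this, Sum.elim_comp_inl_inr]
      exact hy.1
  refine (PPLattice.pullHom_intervalSurjective (X := X) hl).collapseIter_of_map h𝓛
    (PPLattice.pullHom_injective hl) ?_
  rw [key, key]
  exact LatticeCon.sup _ (LatticeCon.inf _ (Setoid.refl' _ _)
    ((PPLattice.pullHom_intervalSurjective (X := X) hr).collapseIter_map h𝓛 h)) (Setoid.refl' _ _)

end Pull

/-! ### Modules in which a collapsed pair of formulas is closed -/

section Kernel

variable {A : Type u} [Ring A] {C : ObjectProperty (ModuleCat.{u} A)} {m : ℕ}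
  {φ ψ : PPFormula A (Fin m)} {σ : PPFormula A (Fin 1)}

/-- The congruence `c` on the pp-formulas over `C` is compatible with projections of the
pair `φ / ψ` along pp-definable relations. -/
def CollapsesPair (C : ObjectProperty (ModuleCat.{u} A)) (φ ψ : PPFormula A (Fin m))
    (c : LatticeCon (PPLattice (Fin 1) C)) : Prop :=
  ∀ Γ : PPFormula A (Fin 1 ⊕ Fin m),
    c.r (PPLattice.mk C (Γ.image ψ)) (PPLattice.mk C (Γ.image φ))

/-- The pp-type of the element `a` of `M` is contained in the filter of all formulas which are
implied by `σ` modulo the congruence `c`. -/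
def TypeBelow (c : LatticeCon (PPLattice (Fin 1) C)) (σ : PPFormula A (Fin 1))
    (M : ModuleCat.{u} A) (a : Fin 1 → M) : Prop :=
  ∀ χ : PPFormula A (Fin 1), a ∈ χ.sol M →
    c.r (PPLattice.mk C σ ⊓ PPLattice.mk C χ) (PPLattice.mk C σ)

variable {c : LatticeCon (PPLattice (Fin 1) C)}

/-- A generic element of `σ`: it satisfies only those formulas which `σ` implies modulo `c`. -/
theorem exists_typeBelow (hC : IsDefinable C) (c : LatticeCon (PPLattice (Fin 1) C))
    (σ : PPFormula A (Fin 1)) :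
    ∃ (M : ModuleCat.{u} A) (_ : C M) (a : Fin 1 → M), a ∈ σ.sol M ∧ TypeBelow c σ M a := by
  obtain ⟨M, hM, a, ha, haχ⟩ := hC.exists_realization (V := Fin 1) (κ := PUnit)
    (ι := {χ : PPFormula A (Fin 1) //
      ¬ c.r (PPLattice.mk C σ ⊓ PPLattice.mk C χ) (PPLattice.mk C σ)})
    (P := fun _ M _ _ h => h ∈ σ.sol M) (Q := fun χ M _ _ h => h ∈ χ.1.sol M)
    (fun _ => PPDef.of_formula σ id) (fun χ => PPDef.of_formula χ.1 id) (by
      rintro s ⟨χ, hχ⟩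
      by_contra! hcon
      refine hχ ?_
      rw [inf_eq_left.2 (PPLattice.mk_le_mk.2 fun M hM x hx => hcon M hM x fun _ _ => hx)])
  refine ⟨M, hM, a, ha PUnit.unit, fun χ hχ => ?_⟩
  by_contra hne
  exact haχ ⟨χ, hne⟩ hχ

/-- A single tuple in `φ` can be moved into `ψ` without enlarging the pp-type of `a` modulo `c`. -/
theorem TypeBelow.exists_single (hC : IsDefinable C) (hc : CollapsesPair C φ ψ c)
    {M : ModuleCat.{u} A} {a : Fin 1 → M} (ha : TypeBelow c σ M a) {b : Fin m → M}
    (hb : b ∈ φ.sol M) :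
    ∃ (M' : ModuleCat.{u} A) (_ : C M') (f : M →ₗ[A] M'),
      TypeBelow c σ M' (f ∘ a) ∧ f ∘ b ∈ ψ.sol M' := by
  obtain ⟨M', hM', h, hpos, hneg⟩ := hC.exists_realization (V := M)
    (κ := {k : PPCond A M // k.Holds (id : M → M)} ⊕ PUnit.{u + 1})
    (ι := {χ : PPFormula A (Fin 1) //
      ¬ c.r (PPLattice.mk C σ ⊓ PPLattice.mk C χ) (PPLattice.mk C σ)})
    (P := fun k => k.elim (fun k M' _ _ h => k.1.Holds h) fun _ M' _ _ h => h ∘ b ∈ ψ.sol M')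
    (Q := fun χ M' _ _ h => h ∘ a ∈ χ.1.sol M')
    (by
      rintro (k | k)
      · exact k.1.ppDef
      · exact PPDef.of_formula ψ b)
    (fun χ => PPDef.of_formula χ.1 a) (by
      rintro s ⟨χ, hχ⟩
      by_contra! hcon
      refine hχ ?_
      -- the relation between `a` and `b` described by the conditions in `s`
      obtain ⟨Γ, hΓ⟩ := (((PPDef.forall_mem_finset s.toLeft fun k _ => k.1.ppDef).rename
        (V := M ⊕ (Fin 1 ⊕ Fin m)) Sum.inl).and (PPDef.forall_fintype fun i : Fin 1 ⊕ Fin m =>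
          PPDef.eq (Sum.inl (Sum.elim a b i)) (Sum.inr i))).exists_family.exists_formula
      have h1 : a ∈ (Γ.image φ).sol M := by
        rw [PPFormula.mem_image]
        exact ⟨b, (hΓ M _).2 ⟨id, fun k _ => k.2, fun i => rfl⟩, hb⟩
      have h2 : PPLattice.mk C (Γ.image ψ) ≤ PPLattice.mk C χ := by
        refine PPLattice.mk_le_mk.2 fun M' hM' x hx => ?_
        obtain ⟨y, hy, hyψ⟩ := PPFormula.mem_image.1 hx
        obtain ⟨h, hs, he⟩ := (hΓ M' _).1 hy
        have hx' : h ∘ a = x := funext fun i => he (Sum.inl i)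
        have hy' : h ∘ b = y := funext fun i => he (Sum.inr i)
        rw [← hx']
        refine hcon M' hM' h ?_
        rintro (k | k) hk
        · exact hs k (Finset.mem_toLeft.2 hk)
        · change h ∘ b ∈ ψ.sol M'
          rwa [hy']
      have h3 : c.r (PPLattice.mk C σ ⊓ PPLattice.mk C (Γ.image ψ)) (PPLattice.mk C σ) :=
        Setoid.trans' _ (c.inf (Setoid.refl' _ _) (hc Γ)) (ha _ h1)
      have h4 := c.sup (Setoid.refl' c.toSetoid (PPLattice.mk C σ ⊓ PPLattice.mk C χ)) h3
      rwa [sup_eq_left.2 (inf_le_inf_left _ h2), sup_eq_right.2 inf_le_left] at h4)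
  obtain ⟨f, rfl⟩ := exists_linearMap_of_conds h fun k hk => hpos (Sum.inl ⟨k, hk⟩)
  refine ⟨M', hM', f, fun χ hχ => ?_, hpos (Sum.inr PUnit.unit)⟩
  by_contra hne
  exact hneg ⟨χ, hne⟩ hχ

/-- All tuples in `φ` can be moved into `ψ` simultaneously. -/
theorem TypeBelow.exists_all (hC : IsDefinable C) (hc : CollapsesPair C φ ψ c)
    {M : ModuleCat.{u} A} (hM : C M) {a : Fin 1 → M} (ha : TypeBelow c σ M a) :
    ∃ (M' : ModuleCat.{u} A) (_ : C M') (f : M →ₗ[A] M'),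
      TypeBelow c σ M' (f ∘ a) ∧ ∀ b ∈ φ.sol M, f ∘ b ∈ ψ.sol M' := by
  classical
  have key : ∀ s : Finset (φ.sol M), ∃ (M' : ModuleCat.{u} A) (_ : C M') (f : M →ₗ[A] M'),
      TypeBelow c σ M' (f ∘ a) ∧ ∀ b ∈ s, f ∘ b.1 ∈ ψ.sol M' := by
    intro s
    induction s using Finset.induction_on with
    | empty => exact ⟨M, hM, LinearMap.id, ha, by simp⟩
    | insert b s _ ih =>
      obtain ⟨M₁, hM₁, f, hf, hs⟩ := ih
      obtain ⟨M₂, hM₂, g, hg, hb⟩ := hf.exists_single hC hc (φ.map_mem_sol f b.2)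
      refine ⟨M₂, hM₂, g ∘ₗ f, hg, ?_⟩
      rw [Finset.forall_mem_insert]
      exact ⟨hb, fun b' hb' => ψ.map_mem_sol g (hs b' hb')⟩
  obtain ⟨M', hM', h, hpos, hneg⟩ := hC.exists_realization (V := M)
    (κ := {k : PPCond A M // k.Holds (id : M → M)} ⊕ φ.sol M)
    (ι := {χ : PPFormula A (Fin 1) //
      ¬ c.r (PPLattice.mk C σ ⊓ PPLattice.mk C χ) (PPLattice.mk C σ)})
    (P := fun k => k.elim (fun k M' _ _ h => k.1.Holds h) fun b M' _ _ h => h ∘ b.1 ∈ ψ.sol M')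
    (Q := fun χ M' _ _ h => h ∘ a ∈ χ.1.sol M')
    (by
      rintro (k | b)
      · exact k.1.ppDef
      · exact PPDef.of_formula ψ b.1)
    (fun χ => PPDef.of_formula χ.1 a) (by
      rintro s ⟨χ, hχ⟩
      obtain ⟨M', hM', f, hf, hs⟩ := key s.toRight
      refine ⟨M', hM', f, ?_, fun hfa => hχ (hf χ hfa)⟩
      rintro (k | b) hk
      · exact k.2.map f
      · exact hs b (Finset.mem_toRight.2 hk))
  obtain ⟨f, rfl⟩ := exists_linearMap_of_conds h fun k hk => hpos (Sum.inl ⟨k, hk⟩)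
  refine ⟨M', hM', f, fun χ hχ => ?_, fun b hb => hpos (Sum.inr ⟨b, hb⟩)⟩
  by_contra hne
  exact hneg ⟨χ, hne⟩ hχ

/-- If `σ ≤ τ` holds on all modules in `C` on which the pair `φ / ψ` is closed, then it holds modulo
`c`. The direct limit of a sequence of extensions which move `φ` into `ψ` is such a module. -/
theorem collapse_of_le_on_closed (hC : IsDefinable C) (hc : CollapsesPair C φ ψ c)
    {τ : PPFormula A (Fin 1)}
    (h : ∀ M : ModuleCat.{u} A, C M → φ.sol M ≤ ψ.sol M → σ.sol M ≤ τ.sol M) :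
    c.r (PPLattice.mk C σ ⊓ PPLattice.mk C τ) (PPLattice.mk C σ) := by
  obtain ⟨M₀, hM₀, a₀, haσ, ha₀⟩ := exists_typeBelow hC c σ
  let Stage := {p : Σ M : ModuleCat.{u} A, (Fin 1 → M) // C p.1 ∧ TypeBelow c σ p.1 p.2}
  have hstep : ∀ s : Stage, ∃ (t : Stage) (f : s.1.1 →ₗ[A] t.1.1), f ∘ s.1.2 = t.1.2 ∧
      ∀ b ∈ φ.sol s.1.1, f ∘ b ∈ ψ.sol t.1.1 := by
    intro s
    obtain ⟨M', hM', f, h1, h2⟩ := s.2.2.exists_all hC hc s.2.1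
    exact ⟨⟨⟨M', f ∘ s.1.2⟩, hM', h1⟩, f, rfl, h2⟩
  choose next f hfa hfb using hstep
  let stage : ℕ → Stage := fun n => Nat.rec ⟨⟨M₀, a₀⟩, hM₀, ha₀⟩ (fun _ s => next s) n
  let G : ℕ ⥤ ModuleCat.{u} A :=
    Functor.ofSequence (X := fun n => (stage n).1.1) fun n => ModuleCat.ofHom (f (stage n))
  have hG : ∀ n, (G.map (homOfLE n.le_succ)).hom = f (stage n) := fun n => by
    rw [Functor.ofSequence_map_homOfLE_succ]
    rfl
  have hGa : ∀ n, (G.map (homOfLE n.zero_le)).hom ∘ a₀ = (stage n).1.2 := by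
    intro n
    induction n with
    | zero =>
      ext i
      rw [Subsingleton.elim (homOfLE (Nat.zero_le 0)) (𝟙 0), G.map_id]
      rfl
    | succ n ih =>
      have h1 : homOfLE (Nat.zero_le (n + 1)) = homOfLE (Nat.zero_le n) ≫ homOfLE n.le_succ :=
        Subsingleton.elim _ _
      have h2 : f (stage n) ∘ ((G.map (homOfLE n.zero_le)).hom ∘ a₀) = (stage (n + 1)).1.2 :=
        (congrArg (fun z => f (stage n) ∘ z) ih).trans (hfa (stage n))
      rw [← hG] at h2
      rw [h1, G.map_comp]
      exact h2
  -- the index category has to live in the universe of the modules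
  let F : ULift.{u} ℕ ⥤ ModuleCat.{u} A :=
    Monotone.functor (f := ULift.down) (fun _ _ h => h) ⋙ G
  have hc' : IsColimit (colimit.cocone F) := colimit.isColimit F
  set N := (colimit.cocone F).pt
  have hN : C N := hC.directLimit _ F _ hc' fun j => (stage j.down).2.1
  have hφψ : φ.sol N ≤ ψ.sol N := by
    intro b hb
    obtain ⟨j, _, y, rfl⟩ := directLimit_exists_family hc' b ⟨0⟩
    have hφ : PPDef A fun M _ _ (h : Fin m → M) => h ∈ φ.sol M := PPDef.of_formula φ id
    have hψ : PPDef A fun M _ _ (h : Fin m → M) => h ∈ ψ.sol M := PPDef.of_formula ψ id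
    obtain ⟨k, hjk, hk⟩ := (hφ.directLimit_iff hc' y).1 hb
    refine (hψ.directLimit_iff hc' y).2 ⟨⟨k.down + 1⟩, hjk.trans (Nat.le_succ k.down), ?_⟩
    have h1 := hfb (stage k.down) _ hk
    rw [← hG] at h1
    have h2 : (F.map (homOfLE (hjk.trans (Nat.le_succ k.down) : j ≤ ⟨k.down + 1⟩))).hom ∘ y =
        (G.map (homOfLE k.down.le_succ)).hom ∘ (F.map (homOfLE hjk)).hom ∘ y :=
      funext fun i => (directLimit_map_map (F := F) (l := ⟨k.down + 1⟩) hjk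
        (Nat.le_succ k.down) (y i)).symm
    rw [h2]
    exact h1
  have hτ : PPDef A fun M _ _ (h : Fin 1 → M) => h ∈ τ.sol M := PPDef.of_formula τ id
  obtain ⟨k, hk0, hk⟩ := (hτ.directLimit_iff hc' (j := ⟨0⟩) a₀).1
    (h N hN hφψ (σ.map_mem_sol ((colimit.cocone F).ι.app ⟨0⟩).hom haσ))
  refine (stage k.down).2.2 τ ?_
  rw [← hGa]
  exact hk

end Kernel

/-! ### Dimensions and interpretation functors -/

section Main

variable {A B : Type u} [Ring A] [Ring B]
  {C : ObjectProperty (ModuleCat.{u} A)} {D : ObjectProperty (ModuleCat.{u} B)}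

/-- Restriction of pp-formulas to a smaller class of modules. -/
def PPLattice.restrict {ν : Type} [Fintype ν] {X Y : ObjectProperty (ModuleCat.{u} A)}
    (h : Y ≤ X) : LatticeHom (PPLattice ν X) (PPLattice ν Y) where
  toFun := Quotient.map (sa := PPFormula.setoidOn ν X) (sb := PPFormula.setoidOn ν Y)
    id fun _ _ hστ M hM => hστ M (h M hM)
  map_sup' a b := by
    induction a using PPLattice.ind
    induction b using PPLattice.ind
    rfl
  map_inf' a b := by
    induction a using PPLattice.ind
    induction b using PPLattice.ind
    rfl

theorem PPLattice.restrict_mk {ν : Type} [Fintype ν] {X Y : ObjectProperty (ModuleCat.{u} A)}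
    (h : Y ≤ X) (σ : PPFormula A ν) :
    PPLattice.restrict h (PPLattice.mk X σ) = PPLattice.mk Y σ := rfl

theorem PPLattice.restrict_surjective {ν : Type} [Fintype ν]
    {X Y : ObjectProperty (ModuleCat.{u} A)} (h : Y ≤ X) :
    Function.Surjective (PPLattice.restrict (ν := ν) h) := by
  intro b
  induction b using PPLattice.ind with | _ σ
  exact ⟨PPLattice.mk X σ, rfl⟩

variable {I : C.FullSubcategory ⥤ D.FullSubcategory} {𝓛 : Set Lat.{u}}

theorem kernelClass_le : kernelClass I ≤ C := fun _ h => h.choose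

theorem Interpretation.mem_kernelClass (T : Interpretation I) {M : ModuleCat.{u} A} (hM : C M)
    (h : T.φ.sol M ≤ T.ψ.sol M) : kernelClass I M := by
  refine ⟨hM, subsingleton_of_forall_eq 0 fun p => ?_⟩
  obtain ⟨x, hx⟩ := T.exists_rep p
  exact hx.unique (rep_zero_iff.2 (h hx.mem))

/-- If the pp-formulas over `D` are collapsed after `γ` steps, then formulas over `C` which agree
on the kernel of `I` are identified after `γ` steps. -/
theorem Interpretation.collapse_of_restrict_eq (T : Interpretation I)
    (h𝓛 : IsClosedLatticeClass 𝓛) (hC : IsDefinable C) (hfull : IsFullOnPureInjectives I)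
    (hgen : definableClosure (imageClass I) = D) {γ : Ordinal.{u}}
    (hγ : Collapses 𝓛 (PPLattice (Fin 1) D) γ) (a b : PPLattice (Fin 1) C)
    (hab : PPLattice.restrict (kernelClass_le (I := I)) a =
      PPLattice.restrict (kernelClass_le (I := I)) b) :
    (collapseIter 𝓛 (PPLattice (Fin 1) C) γ).r a b := by
  induction a using PPLattice.ind with | _ σ
  induction b using PPLattice.ind with | _ τ
  rw [PPLattice.restrict_mk, PPLattice.restrict_mk, PPLattice.mk_eq_mk] at hab
  have hle : PPLattice.mk C T.ψ ≤ PPLattice.mk C T.φ := fun M _ => T.le M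
  obtain ⟨p, hp⟩ := T.starHom_surjOn hC hfull le_rfl hle
  obtain ⟨q, hq⟩ := T.starHom_surjOn hC hfull hle le_rfl
  have h1 := (T.starHom_intervalSurjective hC hfull hgen).collapseIter_map h𝓛 (hγ p q)
  rw [hp, hq] at h1
  have hc : CollapsesPair C T.φ T.ψ (collapseIter 𝓛 (PPLattice (Fin 1) C) γ) := fun Γ =>
    collapseIter_image h𝓛 h1 Γ
  have h2 := collapse_of_le_on_closed (σ := σ) (τ := τ) hC hc fun M hM hφψ =>
    (hab M (T.mem_kernelClass hM hφψ)).le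
  have h3 := collapse_of_le_on_closed (σ := τ) (τ := σ) hC hc fun M hM hφψ =>
    (hab M (T.mem_kernelClass hM hφψ)).ge
  rw [inf_comm] at h3
  exact Setoid.trans' _ (Setoid.symm' _ h2) h3

/-- The upper bound, in terms of the number of steps after which the lattices collapse. -/
theorem Interpretation.collapses_add (T : Interpretation I)
    (h𝓛 : IsClosedLatticeClass 𝓛) (hC : IsDefinable C) (hfull : IsFullOnPureInjectives I)
    (hgen : definableClosure (imageClass I) = D) {γ β : Ordinal.{u}}
    (hγ : Collapses 𝓛 (PPLattice (Fin 1) D) γ)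
    (hβ : Collapses 𝓛 (PPLattice (Fin 1) (kernelClass I)) β) :
    Collapses 𝓛 (PPLattice (Fin 1) C) (γ + β) := fun _ _ =>
  collapseIter_add_of_surjective h𝓛 (PPLattice.restrict_surjective kernelClass_le)
    (T.collapse_of_restrict_eq h𝓛 hC hfull hgen hγ) (hβ _ _)

end Main

theorem mainTheorem4 (𝓛 : Set Lat.{u}) (h_ne : 𝓛.Nonempty) (h_closed : IsClosedLatticeClass 𝓛)
    (R S : Type u) [Ring R] [Ring S]
    (C : ObjectProperty (ModuleCat.{u} Rᵐᵒᵖ)) (D : ObjectProperty (ModuleCat.{u} Sᵐᵒᵖ))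
    (hC : IsDefinable C) (hD : IsDefinable D)
    (I : C.FullSubcategory ⥤ D.FullSubcategory) (hI : IsInterpretationFunctor I)
    (h_full : IsFullOnPureInjectives I) (h_gen : definableClosure (imageClass I) = D) :
    max (latticeDim 𝓛 (PPLattice (Fin 1) D)) (latticeDim 𝓛 (PPLattice (Fin 1) (kernelClass I)))
        ≤ latticeDim 𝓛 (PPLattice (Fin 1) C) ∧
      latticeDim 𝓛 (PPLattice (Fin 1) C)
        ≤ dimAddOneAdd (latticeDim 𝓛 (PPLattice (Fin 1) D))
            (latticeDim 𝓛 (PPLattice (Fin 1) (kernelClass I))) ∧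
      (latticeDim 𝓛 (PPLattice (Fin 1) C) ≠ ⊤ ↔
        latticeDim 𝓛 (PPLattice (Fin 1) (kernelClass I)) ≠ ⊤ ∧
          latticeDim 𝓛 (PPLattice (Fin 1) D) ≠ ⊤) := by
  obtain ⟨T⟩ := hI.nonempty
  have hD_le : latticeDim 𝓛 (PPLattice (Fin 1) D) ≤ latticeDim 𝓛 (PPLattice (Fin 1) C) :=
    latticeDim_le_latticeDim fun γ hγ a b =>
      (T.starHom_intervalSurjective hC h_full h_gen).collapseIter_of_map h_closed
        (T.starHom_injective h_gen) (hγ.of_one h_closed T.m _ _)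
  have hker_le : latticeDim 𝓛 (PPLattice (Fin 1) (kernelClass I)) ≤
      latticeDim 𝓛 (PPLattice (Fin 1) C) := by
    refine latticeDim_le_latticeDim fun γ hγ a b => ?_
    have hsurj := PPLattice.restrict_surjective (ν := Fin 1) (kernelClass_le (I := I))
    obtain ⟨a, rfl⟩ := hsurj a
    obtain ⟨b, rfl⟩ := hsurj b
    exact (intervalSurjective_of_surjective hsurj).collapseIter_map h_closed (hγ a b)
  have hle : latticeDim 𝓛 (PPLattice (Fin 1) C) ≤
      dimAddOneAdd (latticeDim 𝓛 (PPLattice (Fin 1) D))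
        (latticeDim 𝓛 (PPLattice (Fin 1) (kernelClass I))) := by
    cases hd : latticeDim 𝓛 (PPLattice (Fin 1) D) with
    | top => exact le_top
    | coe d =>
      cases hd' : latticeDim 𝓛 (PPLattice (Fin 1) (kernelClass I)) with
      | top => exact le_top
      | coe d' =>
        refine latticeDim_le_iff.2 ?_
        rw [stepsOf_addOneAdd]
        exact T.collapses_add h_closed hC h_full h_gen (latticeDim_le_iff.1 hd.le)
          (latticeDim_le_iff.1 hd'.le)
  refine ⟨max_le hD_le hker_le, hle, fun h => ⟨ne_top_of_le_ne_top h hker_le,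
    ne_top_of_le_ne_top h hD_le⟩, ?_⟩
  rintro ⟨h1, h2⟩
  obtain ⟨d', hd'⟩ := WithTop.ne_top_iff_exists.1 h1
  obtain ⟨d, hd⟩ := WithTop.ne_top_iff_exists.1 h2
  rw [← hd, ← hd'] at hle
  exact ne_top_of_le_ne_top (WithTop.coe_ne_top (a := addOneAdd d d')) hle
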